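/- **Parameterized families and Smoothed-P.** A parameterized family of distributions $\mathcal D=(D_{n,x,\phi})$ consists, for every $n\ge 1$ and every admissible string $x$ of length $n$ ("length" is a problem-dependent size parameter, not necessarily the number of bits) and every admissible value $\phi$ of the perturbation parameter, of a probability distribution $D_{n,x,\phi}$ on $\{0,1\}^*$ such that, with $N_{n,x}=|\{y : D_{n,x,\phi}(y)>0 \text{ for some admissible } \phi\}|$: the support of $D_{n,x,\phi}$ is contained in $\{0,1\}^{\le \mathrm{poly}(n)}$; $D_{n,x,\phi}(y)\le\phi$ for all $y$; $\phi\in[1/N_{n,x},1]$; and $\phi$ is a rational number that is described by at most $\mathrm{poly}(n)$ bits. For a language $L\subseteq\{0,1\}^*$, the pair $(L,\mathcal D)$ is in Smoothed-P if there is a deterministic algorithm $A$ that, on input $(y;n,\phi)$, decides whether $y\in L$, and whose running time $t_A$ satisfies, for some constants $\varepsilon>0$ and $C$ and all $n,x,\phi$, $$\mathbb E_{y\sim D_{n,x,\phi}}\bigl(t_A(y;n,\phi)^{\varepsilon}\bigr)\le C\cdot n\cdot N_{n,x}\cdot\phi .$$ **Binary decision problems.** An instance of size $n$ is a triple $(S,w,t)$,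 where $S\subseteq\{0,1\}^n$ is a set from a fixed family of sets encoded by binary strings, $w=(w_1,\dots,w_n)$ with $w_i\in\{0,1,\dots,2^n-1\}$ is a vector of $n$-bit coefficients, and $t\in\mathbb N$ is a threshold. The question is whether some $x\in S$ satisfies $w^Tx\le t$. (A string that is not meant to encode a set is treated as an encoding of $\emptyset$.) The problem can be solved in pseudo-polynomial time if a deterministic algorithm decides all its instances in time polynomial in the length of the encoding of $(S,w,t)$ and the largest of the numbers $w_1,\dots,w_n,t$. **Perturbation model.** Consider any parameterized family $\mathcal D$ whose strings $x$ of length $n$ are (encoded) instances $(S,w,t)$ of size $n$ of the problem, where $D_{n,x,\phi}$ is the distribution of the instance $(S,w',t)$ with the same $S$ and $t$ and with coefficients $w'_1,\dots,w'_n\in\{0,\dots,2^n-1\}$ drawn independently from distributions (which may depend on $i,n,x,\phi$) under each of which every value has probability at most $\phi^{1/n}$, and where $N_{n,x}=2^{n^2}$. **Theorem.** If a binary decision problem can be solved in pseudo-polynomial time, then, for every such family $\mathcal D$, the problem (the language of its encoded yes-instances) together with $\mathcal D$ is in Smoothed-P. -/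

import Mathlib

open scoped ENNReal NNReal

noncomputable section

namespace SmoothedComplexity

/-! ### Algorithms -/

/-- The deterministic machine `M` (Mathlib's multi-stack Turing machines), started on the input
string `input`, halts after at most `T` steps and its output is the truth value of `answer`. -/
def AnswersWithin {Γ : Type} (M : Turing.TM2ComputableAux Γ Bool) (input : List Γ)
    (answer : Prop) (T : ℕ) : Prop :=
  open Classical in
  Nonempty (Turing.TM2OutputsInTime M.tm (input.map M.inputAlphabet.symm)
    (some [M.outputAlphabet.symm (decide answer)]) T)

/-! ### Parameterized distributional problems -/

/-- All strings that have positive probability under `d φ` for some admissible `φ`. -/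
def unionSupport (Φ : Set ℚ≥0) (d : ℚ≥0 → PMF (List Bool)) : Set (List Bool) :=
  {y | ∃ φ ∈ Φ, d φ y ≠ 0}

/-- A parameterized family of distributions `(D_{n,x,φ})`. The strings `x` of length `n`
("length" in the sense of the problem, not necessarily the number of bits) form the set `orig n`,
and `Φ n x` is the set of the (discretized) values that the perturbation parameter may take. The
values of `dist` outside of these sets are irrelevant. -/
structure ParamFamily where
  orig : ℕ → Set (List Bool)
  Φ : ℕ → List Bool → Set ℚ≥0
  dist : ℕ → List Bool → ℚ≥0 → PMF (List Bool)
  /-- lengths are positive -/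
  length_pos : ∀ n, ∀ x ∈ orig n, 0 < n
  /-- `D_{n,x,φ}` lives on the strings of length at most `poly(n)` -/
  support_poly : ∃ p : Polynomial ℕ, ∀ n, ∀ x ∈ orig n, ∀ φ ∈ Φ n x, ∀ y,
    dist n x φ y ≠ 0 → y.length ≤ p.eval n
  /-- no string has probability more than `φ` -/
  dist_le : ∀ n, ∀ x ∈ orig n, ∀ φ ∈ Φ n x, ∀ y, dist n x φ y ≤ ((φ : ℝ≥0) : ℝ≥0∞)
  /-- `φ ∈ [1 / N_{n,x}, 1]` -/
  param_mem : ∀ n, ∀ x ∈ orig n, ∀ φ ∈ Φ n x,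
    1 / ((unionSupport (Φ n x) (dist n x)).ncard : ℚ≥0) ≤ φ ∧ φ ≤ 1
  /-- `φ` is described by at most `poly(n)` bits -/
  param_poly : ∃ p : Polynomial ℕ, ∀ n, ∀ x ∈ orig n, ∀ φ ∈ Φ n x,
    φ.num.size + φ.den.size ≤ p.eval n

/-- `N_{n,x}`: the number of strings `y` with `D_{n,x,φ}(y) > 0` for some `φ`. -/
def ParamFamily.N (D : ParamFamily) (n : ℕ) (x : List Bool) : ℕ :=
  (unionSupport (D.Φ n x) (D.dist n x)).ncard

/-- The input `(y; n, φ)` of an algorithm: `y`, `n` and the numerator and the denominator of `φ`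
in binary, separated by the symbol `none`. -/
def algInput (y : List Bool) (n : ℕ) (φ : ℚ≥0) : List (Option Bool) :=
  y.map some ++ none :: (n.bits.map some ++ none :: (φ.num.bits.map some ++ none ::
    φ.den.bits.map some))

/-- A running time `T y n φ` is smoothed polynomial with respect to `D`: there is an `ε > 0` with
`E_{y ∼ D_{n,x,φ}} (T(y; n, φ) ^ ε) = O(n * N_{n,x} * φ)`. -/
def HasSmoothedPolyTime (T : List Bool → ℕ → ℚ≥0 → ℕ) (D : ParamFamily) : Prop :=
  ∃ ε : ℝ, 0 < ε ∧ ∃ C : ℝ≥0, ∀ n, ∀ x ∈ D.orig n, ∀ φ ∈ D.Φ n x,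
    ∑' y, D.dist n x φ y * (T y n φ : ℝ≥0∞) ^ ε
      ≤ ((C * (n * D.N n x * (φ : ℝ≥0)) : ℝ≥0) : ℝ≥0∞)

/-- The class Smoothed-P: all `(L, D)` such that a deterministic algorithm with smoothed
polynomial running time with respect to `D` decides `L`. -/
def SmoothedP : Set (Language Bool × ParamFamily) :=
  {LD | ∃ (A : Turing.TM2ComputableAux (Option Bool) Bool) (T : List Bool → ℕ → ℚ≥0 → ℕ),
    (∀ y n φ, AnswersWithin A (algInput y n φ) (y ∈ LD.1) (T y n φ)) ∧
    HasSmoothedPolyTime T LD.2}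

/-! ### Binary decision problems -/

/-- A binary decision problem is given by the sets `S ⊆ {0,1}^n` that can occur in its instances:
`solutions n s` is the set that is encoded by the string `s`. (Strings that are not meant to
encode a set encode the empty set.) -/
structure BinaryDecisionProblem where
  solutions : (n : ℕ) → List Bool → Set (Fin n → Bool)

/-- The value `wᵀ x` for `n`-bit coefficients `w` and a binary vector `x`. -/
def weight {n : ℕ} (w : Fin n → Fin (2 ^ n)) (x : Fin n → Bool) : ℕ :=
  ∑ i, (w i : ℕ) * (x i).toNat

/-- The largest number in an instance with coefficients `w` and threshold `t`. -/
def maxNumber {n : ℕ} (w : Fin n → Fin (2 ^ n)) (t : ℕ) : ℕ :=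
  max (Finset.univ.sup fun i => (w i : ℕ)) t

/-- The string that encodes the instance `(S, w, t)` of size `n`, where `s` encodes `S`: it
consists of `n` in unary, the string `s` (each bit preceded by `1`, and a final `0`), the
coefficients with exactly `n` bits each, and the threshold in binary. -/
def encodeInstance (n : ℕ) (s : List Bool) (w : Fin n → Fin (2 ^ n)) (t : ℕ) : List Bool :=
  (List.replicate n true ++ [false]) ++
  (s.flatMap (fun b => [true, b]) ++ [false]) ++
  (List.ofFn fun i : Fin n => List.ofFn fun j : Fin n => (w i : ℕ).testBit j).flatten ++
  t.bits

namespace BinaryDecisionProblem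

/-- The answer to the instance `(S, w, t)`: is there an `x ∈ S` with `wᵀ x ≤ t`? -/
def Yes (P : BinaryDecisionProblem) (n : ℕ) (s : List Bool) (w : Fin n → Fin (2 ^ n))
    (t : ℕ) : Prop :=
  ∃ x ∈ P.solutions n s, weight w x ≤ t

/-- The set of the (encoded) yes-instances. -/
def language (P : BinaryDecisionProblem) : Language Bool :=
  {y | ∃ n s w t, y = encodeInstance n s w t ∧ P.Yes n s w t}

/-- `P` can be solved in pseudo-polynomial time: some deterministic algorithm solves all its
instances in time polynomial in the length of the instance and the largest number in it. -/
def SolvableInPseudoPolyTime (P : BinaryDecisionProblem) : Prop :=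
  ∃ (M : Turing.TM2ComputableAux Bool Bool) (p : Polynomial ℕ), ∀ n s w t,
    AnswersWithin M (encodeInstance n s w t) (P.Yes n s w t)
      (p.eval ((encodeInstance n s w t).length + maxNumber w t))

end BinaryDecisionProblem

/-- The law of a vector whose coordinates are independent with laws `p i`. -/
def independentLaw {n : ℕ} {α : Type} [Fintype α] (p : Fin n → PMF α) : PMF (Fin n → α) :=
  PMF.ofFintype (fun w => ∏ i, p i (w i)) (by
    classical
    rw [← Fintype.prod_sum (fun i a => p i a)]
    refine Finset.prod_eq_one fun i _ => ?_
    exact (tsum_fintype _).symm.trans (p i).tsum_coe)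

/-- The perturbation model for binary decision problems: the strings `x` of length `n` are
instances `(S, w, t)` of size `n`; `S` and `t` are not perturbed, and the adversary replaces `w`
by coefficients that are drawn independently, each from a distribution that is bounded from above
by `φ^(1/n)`; and `N_{n,x} = 2^(n^2)`. The distributions may depend on `n`, `x` and `φ`. -/
def IsPerturbationModel (D : ParamFamily) : Prop :=
  ∀ n, ∀ x ∈ D.orig n, D.N n x = 2 ^ (n ^ 2) ∧
    ∃ (s : List Bool) (w : Fin n → Fin (2 ^ n)) (t : ℕ), x = encodeInstance n s w t ∧
      ∀ φ ∈ D.Φ n x, ∃ p : Fin n → PMF (Fin (2 ^ n)),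
        (∀ i a, p i a ≤ ((φ : ℝ≥0) : ℝ≥0∞) ^ (1 / (n : ℝ))) ∧
        D.dist n x φ = (independentLaw p).map fun w' => encodeInstance n s w' t

end SmoothedComplexity

end

/-! The algorithm raises the precision step by step. At precision `j` it drops the `b = n - j`
lowest bits of every coefficient and of the threshold and passes the result to the pseudo-polynomial
algorithm. All numbers are then at most `4 ^ j`, so a query costs a polynomial in the length and `2
^ j`. Rounding the coefficients down underestimates weights, so "no" is reliable; rounding them up
overestimates weights, so "yes" is reliable. If neither happens, the next precision is tried; at `j
= n` nothing is rounded.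

If `2 ^ j > n` and precision `j` leaves the answer open, the optimum `z` of the rounded-down weights
satisfies `z ≤ τ < z + n` with `τ = ⌊t / 2 ^ b⌋`, since rounding up adds at most `n`
(`exists_closeAt`). An optimal solution then contains some item `i`. With the other coefficients
fixed, optimal solutions containing `i` all have the same weight outside `i`, whatever the
coefficient of `i` is. So `⌊w i / 2 ^ b⌋` is confined to `n` consecutive integers, that is, `w i` to
`n * 2 ^ b` values (`card_closeAt_le`). With `ψ = φ ^ (1 / n)` and a union bound over `i`, the
answer is still open before round `i = j + 1` with probability at most `2 * n ^ 2 * X / 2 ^ i`,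
where `X = 2 ^ n * ψ` (`known_eq_none_sum_mul_le`).

Round `i` takes time `C * (n * 2 ^ i) ^ d`. For `ε = 1 / (8 * d)` its `ε`-th power grows like `2 ^
(i / 8)`, which the decay of the probability outweighs, so the expectation is dominated by a
geometric series with sum `O(n * X)` (`mul_rpow_le`, `sum_rpow_le`). Finally `1 ≤ X` and `X ^ n = 2
^ (n ^ 2) * φ = N * φ`, hence `X ≤ N * φ`.

Membership in Smoothed-P asks for an actual multi-stack machine. The algorithm is therefore written
in a small imperative language with step counts (`Exec`) and compiled to a machine that contains the
given one as a subroutine (`Exec.reachesIn`, `machine_outputs`). -/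

open scoped ENNReal NNReal

noncomputable section

namespace SmoothedComplexity

/-! ### A small imperative language for multi-stack machines with a subroutine -/

/-- The registers of a program. -/
inductive Reg
  | input | size | rounds | sol | coeff | coeff2 | thr | thr2 | low | high | query | aux | aux2
  deriving DecidableEq

instance : Fintype Reg where
  elems := {.input, .size, .rounds, .sol, .coeff, .coeff2, .thr, .thr2, .low, .high, .query, .aux,
    .aux2}
  complete r := by cases r <;> decide

/-- The contents of the registers. -/
structure Regs where
  input : List (Option Bool) := []
  size : List (Option Bool) := []
  rounds : List (Option Bool) := []
  sol : List (Option Bool) := []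
  coeff : List (Option Bool) := []
  coeff2 : List (Option Bool) := []
  thr : List (Option Bool) := []
  thr2 : List (Option Bool) := []
  low : List (Option Bool) := []
  high : List (Option Bool) := []
  query : List (Option Bool) := []
  aux : List (Option Bool) := []
  aux2 : List (Option Bool) := []

/-- The content of a register. -/
def Regs.get (ρ : Regs) : Reg → List (Option Bool)
  | .input => ρ.input
  | .size => ρ.size
  | .rounds => ρ.rounds
  | .sol => ρ.sol
  | .coeff => ρ.coeff
  | .coeff2 => ρ.coeff2
  | .thr => ρ.thr
  | .thr2 => ρ.thr2
  | .low => ρ.low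
  | .high => ρ.high
  | .query => ρ.query
  | .aux => ρ.aux
  | .aux2 => ρ.aux2

/-- Overwriting a register. -/
def Regs.set (ρ : Regs) (r : Reg) (l : List (Option Bool)) : Regs :=
  match r with
  | .input => { ρ with input := l }
  | .size => { ρ with size := l }
  | .rounds => { ρ with rounds := l }
  | .sol => { ρ with sol := l }
  | .coeff => { ρ with coeff := l }
  | .coeff2 => { ρ with coeff2 := l }
  | .thr => { ρ with thr := l }
  | .thr2 => { ρ with thr2 := l }
  | .low => { ρ with low := l }
  | .high => { ρ with high := l }
  | .query => { ρ with query := l }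
  | .aux => { ρ with aux := l }
  | .aux2 => { ρ with aux2 := l }

theorem Regs.get_set (ρ : Regs) (r : Reg) (l : List (Option Bool)) :
    (ρ.set r l).get = Function.update ρ.get r l := by
  funext r'
  cases r <;> cases r' <;> rfl

theorem Regs.ext_get {ρ ρ' : Regs} (h : ρ.get = ρ'.get) : ρ = ρ' := by
  cases ρ; cases ρ'
  have h' := congrFun h
  simp only [Regs.mk.injEq]
  exact ⟨h' .input, h' .size, h' .rounds, h' .sol, h' .coeff, h' .coeff2, h' .thr, h' .thr2,
    h' .low, h' .high, h' .query, h' .aux, h' .aux2⟩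

@[simp] theorem Regs.get_set_self (ρ : Regs) (r : Reg) (l : List (Option Bool)) :
    (ρ.set r l).get r = l := by
  simp [Regs.get_set]

theorem Regs.get_set_of_ne (ρ : Regs) {r r' : Reg} (h : r' ≠ r) (l : List (Option Bool)) :
    (ρ.set r l).get r' = ρ.get r' := by
  simp [Regs.get_set, h]

@[simp] theorem Regs.set_set (ρ : Regs) (r : Reg) (l l' : List (Option Bool)) :
    (ρ.set r l).set r l' = ρ.set r l' :=
  Regs.ext_get (by simp [Regs.get_set])

theorem Regs.set_comm (ρ : Regs) {r r' : Reg} (h : r ≠ r') (l l' : List (Option Bool)) :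
    (ρ.set r l).set r' l' = (ρ.set r' l').set r l :=
  Regs.ext_get (by simp [Regs.get_set, Function.update_comm h])

@[simp] theorem Regs.set_get_self (ρ : Regs) (r : Reg) : ρ.set r (ρ.get r) = ρ :=
  Regs.ext_get (by simp [Regs.get_set])

/-- The finite memory of a program. -/
structure Vars where
  cur : Option (Option Bool) := none
  valid : Bool := true
  carry : Bool := false
  ceil : Bool := false
  big : Bool := false
  res : Bool := false
  ans : Option Bool := none

instance : Fintype Vars :=
  Fintype.ofInjective
    (fun v : Vars => (v.cur, v.valid, v.carry, v.ceil, v.big, v.res, v.ans))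
    (by rintro ⟨⟩ ⟨⟩; simp)

/-- Programs. The command `call` consumes the register `query` and runs a subroutine on it. -/
inductive Prog
  | pop (r : Reg)
  | push (r : Reg) (f : Vars → Option Bool)
  | load (f : Vars → Vars)
  | seq (p q : Prog)
  | ite (c : Vars → Bool) (p q : Prog)
  | loop (c : Vars → Bool) (p : Prog)
  | call

/-- `Exec Q p s k s'`: when started in `s`, the program `p` terminates in `s'` after at most `k`
steps. The relation `Q` describes the answers and the running times of the subroutine. -/
inductive Exec (Q : List Bool → Bool → ℕ → Prop) :
    Prog → Vars × Regs → ℕ → Vars × Regs → Prop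
  | pop (r v ρ) : Exec Q (.pop r) (v, ρ) 1
      ({ v with cur := (ρ.get r).head? }, ρ.set r (ρ.get r).tail)
  | push (r f v ρ) : Exec Q (.push r f) (v, ρ) 1 (v, ρ.set r (f v :: ρ.get r))
  | load (f v ρ) : Exec Q (.load f) (v, ρ) 1 (f v, ρ)
  | seq {p q a b c k l} : Exec Q p a k b → Exec Q q b l c → Exec Q (.seq p q) a (k + l) c
  | ite_true {c p q a b k} : c a.1 = true → Exec Q p a k b → Exec Q (.ite c p q) a (k + 1) b
  | ite_false {c p q a b k} : c a.1 = false → Exec Q q a k b → Exec Q (.ite c p q) a (k + 1) b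
  | loop_false {c p a} : c a.1 = false → Exec Q (.loop c p) a 1 a
  | loop_true {c p a b d k l} : c a.1 = true → Exec Q p a k b → Exec Q (.loop c p) b l d →
      Exec Q (.loop c p) a (k + l + 1) d
  | call {v ρ b k} : Q (ρ.query.reverse.map fun g => g.getD false) b k →
      Exec Q .call (v, ρ) (ρ.query.length + k + 2)
        ({ v with cur := none, res := b }, { ρ with query := [] })
  | weaken {p a b k l} : Exec Q p a k b → k ≤ l → Exec Q p a l b

/-! ### Compilation -/

open Turing

section Compile

variable (M : TM2ComputableAux Bool Bool)

/-- The stack alphabets of the compiled machine. -/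
def StackAlphabet : M.tm.K ⊕ Reg → Type
  | .inl k => M.tm.Γ k
  | .inr _ => Option Bool

/-- The stacks of the compiled machine. -/
def stackContents (S : ∀ k, List (M.tm.Γ k)) (ρ : Regs) : ∀ k, List (StackAlphabet M k)
  | .inl k => S k
  | .inr r => ρ.get r

theorem update_stackContents_inl (S : ∀ k, List (M.tm.Γ k)) (ρ : Regs) (k : M.tm.K)
    (l : List (M.tm.Γ k)) :
    Function.update (β := fun k => List (StackAlphabet M k)) (stackContents M S ρ) (.inl k) l =
      stackContents M (Function.update S k l) ρ := by
  funext k'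
  rcases k' with k' | r
  · by_cases h : k' = k
    · subst h
      exact (Function.update_self ..).trans (Function.update_self k' l S).symm
    · have h' : Function.update S k l k' = S k' := Function.update_of_ne h l S
      exact (Function.update_of_ne (by simpa using h) ..).trans h'.symm
  · exact Function.update_of_ne (by simp) ..

theorem update_stackContents_inr (S : ∀ k, List (M.tm.Γ k)) (ρ : Regs) (r : Reg)
    (l : List (Option Bool)) :
    Function.update (β := fun k => List (StackAlphabet M k)) (stackContents M S ρ) (.inr r) l =
      stackContents M S (ρ.set r l) := by
  funext k'
  rcases k' with k' | r'
  · exact Function.update_of_ne (by simp) ..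
  · by_cases h : r' = r
    · subst h
      exact (Function.update_self ..).trans (ρ.get_set_self r' l).symm
    · exact (Function.update_of_ne (by simpa using h) ..).trans (ρ.get_set_of_ne h l).symm

/-- The labels of a compiled program. -/
def Lab : Prog → Type
  | .pop _ => Unit
  | .push _ _ => Unit
  | .load _ => Unit
  | .seq p q => Lab p ⊕ Lab q
  | .ite _ p q => Option (Lab p ⊕ Lab q)
  | .loop _ p => Option (Lab p)
  | .call => Option (Option M.tm.Λ)

instance labFintype : ∀ p : Prog, Fintype (Lab M p)
  | .pop _ => inferInstanceAs (Fintype Unit)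
  | .push _ _ => inferInstanceAs (Fintype Unit)
  | .load _ => inferInstanceAs (Fintype Unit)
  | .seq p q =>
    letI := labFintype p
    letI := labFintype q
    inferInstanceAs (Fintype (Lab M p ⊕ Lab M q))
  | .ite _ p q =>
    letI := labFintype p
    letI := labFintype q
    inferInstanceAs (Fintype (Option (Lab M p ⊕ Lab M q)))
  | .loop _ p =>
    letI := labFintype p
    inferInstanceAs (Fintype (Option (Lab M p)))
  | .call =>
    letI := M.tm.ΛFin
    inferInstanceAs (Fintype (Option (Option M.tm.Λ)))

/-- The first label of a compiled program. -/
def entry : ∀ p : Prog, Lab M p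
  | .pop _ => ()
  | .push _ _ => ()
  | .load _ => ()
  | .seq p _ => .inl (entry p)
  | .ite _ _ _ => none
  | .loop _ _ => none
  | .call => none

variable {Λ : Type}

/-- A statement of the subroutine as a statement of the compiled machine. -/
def embedStmt (f : M.tm.Λ → Λ) (ret : Λ) :
    TM2.Stmt M.tm.Γ M.tm.Λ M.tm.σ → TM2.Stmt (StackAlphabet M) Λ (M.tm.σ × Vars)
  | .push k g q => .push (.inl k) (fun s => g s.1) (embedStmt f ret q)
  | .peek k g q => .peek (.inl k) (fun s o => (g s.1 o, s.2)) (embedStmt f ret q)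
  | .pop k g q => .pop (.inl k) (fun s o => (g s.1 o, s.2)) (embedStmt f ret q)
  | .load g q => .load (fun s => (g s.1, s.2)) (embedStmt f ret q)
  | .branch g q₁ q₂ => .branch (fun s => g s.1) (embedStmt f ret q₁) (embedStmt f ret q₂)
  | .goto g => .goto fun s => f (g s.1)
  | .halt => .goto fun _ => ret

/-- The statements of a compiled program whose labels are embedded by `emb`. -/
def compile : ∀ p : Prog, (Lab M p → Λ) → Λ → Lab M p →
    TM2.Stmt (StackAlphabet M) Λ (M.tm.σ × Vars)
  | .pop r, _, exit, _ =>
    .pop (.inr r) (fun s o => (s.1, { s.2 with cur := o })) (.goto fun _ => exit)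
  | .push r f, _, exit, _ => .push (.inr r) (fun s => f s.2) (.goto fun _ => exit)
  | .load f, _, exit, _ => .load (fun s => (s.1, f s.2)) (.goto fun _ => exit)
  | .seq p q, emb, _, .inl l => compile p (fun l => emb (.inl l)) (emb (.inr (entry M q))) l
  | .seq _ q, emb, exit, .inr l => compile q (fun l => emb (.inr l)) exit l
  | .ite c p q, emb, _, none =>
    .branch (fun s => c s.2) (.goto fun _ => emb (some (.inl (entry M p))))
      (.goto fun _ => emb (some (.inr (entry M q))))
  | .ite _ p _, emb, exit, some (.inl l) => compile p (fun l => emb (some (.inl l))) exit l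
  | .ite _ _ q, emb, exit, some (.inr l) => compile q (fun l => emb (some (.inr l))) exit l
  | .loop c p, emb, exit, none =>
    .branch (fun s => c s.2) (.goto fun _ => emb (some (entry M p))) (.goto fun _ => exit)
  | .loop _ p, emb, _, some l => compile p (fun l => emb (some l)) (emb none) l
  | .call, emb, _, none =>
    .pop (.inr .query) (fun s o => (s.1, { s.2 with cur := o }))
      (.branch (fun s => s.2.cur.isSome)
        (.push (.inl M.tm.k₀)
          (fun s => M.inputAlphabet.symm ((s.2.cur.getD none).getD false))
          (.goto fun _ => emb none))
        (.goto fun _ => emb (some (some M.tm.main))))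
  | .call, _, exit, some none =>
    .pop (.inl M.tm.k₁)
      (fun s o => (s.1, { s.2 with res := (o.map M.outputAlphabet).getD false }))
      (.goto fun _ => exit)
  | .call, emb, _, some (some l) =>
    embedStmt M (fun l => emb (some (some l))) (emb (some none)) (M.tm.m l)

/-! ### Simulation of programs by the compiled machine. -/

/-- Reachability within a number of steps. -/
def ReachesIn {σ : Type*} (f : σ → Option σ) (k : ℕ) (a b : σ) : Prop :=
  ∃ j ≤ k, (flip bind f)^[j] (some a) = some b

theorem ReachesIn.trans {σ : Type*} {f : σ → Option σ} {k l : ℕ} {a b c : σ}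
    (h : ReachesIn f k a b) (h' : ReachesIn f l b c) : ReachesIn f (k + l) a c := by
  obtain ⟨i, hi, h⟩ := h
  obtain ⟨j, hj, h'⟩ := h'
  exact ⟨j + i, by omega, by rw [Function.iterate_add_apply, h, h']⟩

theorem ReachesIn.mono {σ : Type*} {f : σ → Option σ} {k l : ℕ} {a b : σ}
    (h : ReachesIn f k a b) (hkl : k ≤ l) : ReachesIn f l a b :=
  let ⟨i, hi, h⟩ := h
  ⟨i, hi.trans hkl, h⟩

theorem ReachesIn.refl {σ : Type*} (f : σ → Option σ) (k : ℕ) (a : σ) : ReachesIn f k a a :=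
  ⟨0, Nat.zero_le _, rfl⟩

theorem ReachesIn.single {σ : Type*} {f : σ → Option σ} {a b : σ} (h : f a = some b) :
    ReachesIn f 1 a b :=
  ⟨1, le_rfl, h⟩

variable {M}

/-- An embedded statement sees only the `Sum.inl` stacks and the first component of the memory, so
registers and program variables pass through unchanged. `halt` becomes a jump to `ret`, which is how
control returns from the subroutine. -/
theorem stepAux_embedStmt (f : M.tm.Λ → Λ) (ret : Λ) (q : TM2.Stmt M.tm.Γ M.tm.Λ M.tm.σ)
    (s : M.tm.σ) (v : Vars) (S : ∀ k, List (M.tm.Γ k)) (ρ : Regs) :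
    TM2.stepAux (embedStmt M f ret q) (s, v) (stackContents M S ρ) =
      let c := TM2.stepAux q s S
      ⟨some ((c.l.map f).getD ret), (c.var, v), stackContents M c.stk ρ⟩ := by
  induction q generalizing s S with
  | push k g q ih =>
    simp only [embedStmt, TM2.stepAux]
    erw [update_stackContents_inl]
    exact ih _ _
  | peek k g q ih => exact ih _ _
  | pop k g q ih =>
    simp only [embedStmt, TM2.stepAux]
    erw [update_stackContents_inl]
    exact ih _ _
  | load g q ih => exact ih _ _
  | branch g q₁ q₂ ih₁ ih₂ =>
    simp only [embedStmt, TM2.stepAux]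
    cases g s
    · exact ih₂ _ _
    · exact ih₁ _ _
  | goto g => rfl
  | halt => rfl

/-- A run of the subroutine inside the compiled machine. -/
theorem iterate_step_embed {m : Λ → TM2.Stmt (StackAlphabet M) Λ (M.tm.σ × Vars)}
    {f : M.tm.Λ → Λ} {ret : Λ} (hm : ∀ l, m (f l) = embedStmt M f ret (M.tm.m l))
    (v : Vars) (ρ : Regs) (k : ℕ) (l : M.tm.Λ) (s : M.tm.σ) (S : ∀ k, List (M.tm.Γ k))
    (s' : M.tm.σ) (S' : ∀ k, List (M.tm.Γ k))
    (h : (flip bind (TM2.step M.tm.m))^[k] (some ⟨some l, s, S⟩) = some ⟨none, s', S'⟩) :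
    ReachesIn (TM2.step m) k ⟨some (f l), (s, v), stackContents M S ρ⟩
      ⟨some ret, (s', v), stackContents M S' ρ⟩ := by
  induction k generalizing l s S with
  | zero => simp at h
  | succ k ih =>
    rw [Function.iterate_succ_apply] at h
    change (flip bind (TM2.step M.tm.m))^[k] (some (TM2.stepAux (M.tm.m l) s S)) = _ at h
    have h1 : TM2.step m ⟨some (f l), (s, v), stackContents M S ρ⟩ = some
        (let c := TM2.stepAux (M.tm.m l) s S
        ⟨some ((c.l.map f).getD ret), (c.var, v), stackContents M c.stk ρ⟩) := by
      simp only [TM2.step, hm, stepAux_embedStmt]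
    rw [Nat.add_comm]
    refine (ReachesIn.single h1).trans ?_
    generalize TM2.stepAux (M.tm.m l) s S = c at h
    rcases c with ⟨_ | l', s'', S''⟩
    · rcases k with _ | k
      · simp only [Function.iterate_zero, id, Option.some.injEq, TM2.Cfg.mk.injEq, true_and] at h
        obtain ⟨rfl, h⟩ := h
        cases h
        exact ReachesIn.refl _ _ _
      -- A halted configuration steps to `none`, and `none` is absorbing; steps left over after
      -- halting contradict `h`.
      · rw [Function.iterate_succ_apply] at h
        exfalso
        have hn : ∀ j, (flip bind (TM2.step M.tm.m))^[j] none = none := fun j =>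
          Function.iterate_fixed rfl j
        change (flip bind (TM2.step M.tm.m))^[k] none = _ at h
        rw [hn] at h
        cases h
    · exact ih _ _ _ h

theorem initList_eq (A : FinTM2) (l : List (A.Γ A.k₀)) :
    initList A l = ⟨some A.main, A.initialState, Function.update (fun _ => []) A.k₀ l⟩ := by
  unfold initList
  congr 1
  funext k
  by_cases h : k = A.k₀
  · subst h; simp
  · simp [h]

/-- Halting includes cleaning up: the memory is initial again and every stack except the output
stack is empty. Popping the answer thus restores the situation before the call, which makes repeated
calls of the subroutine possible. -/
theorem haltList_eq (A : FinTM2) (l : List (A.Γ A.k₁)) :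
    haltList A l = ⟨none, A.initialState, Function.update (fun _ => []) A.k₁ l⟩ := by
  unfold haltList
  congr 1
  funext k
  by_cases h : k = A.k₁
  · subst h; simp
  · simp [h]

/-- The subroutine `M` answers `b` on `x` after at most `k` steps. -/
def Answers (M : TM2ComputableAux Bool Bool) (x : List Bool) (b : Bool) (k : ℕ) : Prop :=
  Nonempty (TM2OutputsInTime M.tm (x.map M.inputAlphabet.symm)
    (some [M.outputAlphabet.symm b]) k)

/-- A configuration of the compiled machine between two commands. -/
def cfg (M : TM2ComputableAux Bool Bool) (l : Λ) (a : Vars × Regs) :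
    TM2.Cfg (StackAlphabet M) Λ (M.tm.σ × Vars) :=
  ⟨some l, (M.tm.initialState, a.1), stackContents M (fun _ => []) a.2⟩

theorem step_of_eq {m : Λ → TM2.Stmt (StackAlphabet M) Λ (M.tm.σ × Vars)} {l : Λ}
    {q : TM2.Stmt (StackAlphabet M) Λ (M.tm.σ × Vars)} (h : m l = q) (s : M.tm.σ × Vars)
    (S : ∀ k, List (StackAlphabet M k)) :
    TM2.step m ⟨some l, s, S⟩ = some (TM2.stepAux q s S) := by
  rw [← h]; rfl

/-- Moving a stack onto another reverses it, so the symbol written first ends on top of the input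
stack and queries can be written in reading order. The additional step is the pop that finds `query`
empty. -/
theorem reachesIn_transfer {m : Λ → TM2.Stmt (StackAlphabet M) Λ (M.tm.σ × Vars)}
    {emb : Lab M .call → Λ} {exit : Λ} (hm : ∀ l, m (emb l) = compile M .call emb exit l)
    (l : List (Option Bool)) (v : Vars) (ρ : Regs) (x : List (M.tm.Γ M.tm.k₀)) :
    ReachesIn (TM2.step m) (l.length + 1)
      ⟨some (emb none), (M.tm.initialState, v),
        stackContents M (Function.update (fun _ => []) M.tm.k₀ x) { ρ with query := l }⟩
      ⟨some (emb (some (some M.tm.main))), (M.tm.initialState, { v with cur := none }),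
        stackContents M (Function.update (fun _ => []) M.tm.k₀
          ((l.reverse.map fun g => M.inputAlphabet.symm (g.getD false)) ++ x))
          { ρ with query := [] }⟩ := by
  induction l generalizing v x with
  | nil =>
    refine ReachesIn.single ?_
    refine (step_of_eq (hm none) _ _).trans ?_
    simp only [compile, TM2.stepAux]
    erw [update_stackContents_inr]
    rfl
  | cons g l ih =>
    have h := ih { v with cur := some g } (M.inputAlphabet.symm (g.getD false) :: x)
    simp only [List.reverse_cons, List.map_append, List.map_cons, List.map_nil,
      List.append_assoc, List.singleton_append]
    rw [List.length_cons, Nat.add_comm]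
    refine (ReachesIn.single ?_).trans h
    refine (step_of_eq (hm none) _ _).trans ?_
    simp only [compile, TM2.stepAux]
    erw [update_stackContents_inr]
    erw [update_stackContents_inl]
    simp only [stackContents, Function.update_self]
    erw [Function.update_idem]
    rfl

/-- A program execution is carried out by the compiled machine. -/
theorem Exec.reachesIn {p : Prog} {a b : Vars × Regs} {k : ℕ} (h : Exec (Answers M) p a k b)
    {m : Λ → TM2.Stmt (StackAlphabet M) Λ (M.tm.σ × Vars)} (emb : Lab M p → Λ) (exit : Λ)
    (hm : ∀ l, m (emb l) = compile M p emb exit l) :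
    ReachesIn (TM2.step m) k (cfg M (emb (entry M p)) a) (cfg M exit b) := by
  induction h generalizing exit with
  | pop r v ρ =>
    refine ReachesIn.single ?_
    refine (step_of_eq (hm ()) _ _).trans ?_
    simp only [compile, TM2.stepAux]
    erw [update_stackContents_inr]
    rfl
  | push r f v ρ =>
    refine ReachesIn.single ?_
    refine (step_of_eq (hm ()) _ _).trans ?_
    simp only [compile, TM2.stepAux]
    erw [update_stackContents_inr]
    rfl
  | load f v ρ => exact ReachesIn.single (step_of_eq (hm ()) _ _)
  | seq _ _ ih₁ ih₂ =>
    exact (ih₁ (fun l => emb (.inl l)) _ fun l => hm (.inl l)).trans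
      (ih₂ (fun l => emb (.inr l)) _ fun l => hm (.inr l))
  | ite_true hc _ ih =>
    rw [Nat.add_comm]
    refine (ReachesIn.single ?_).trans (ih (fun l => emb (some (.inl l))) _
      fun l => hm (some (.inl l)))
    refine (step_of_eq (hm none) _ _).trans ?_
    simp only [compile, TM2.stepAux, hc, cond_true]
    rfl
  | ite_false hc _ ih =>
    rw [Nat.add_comm]
    refine (ReachesIn.single ?_).trans (ih (fun l => emb (some (.inr l))) _
      fun l => hm (some (.inr l)))
    refine (step_of_eq (hm none) _ _).trans ?_
    simp only [compile, TM2.stepAux, hc, cond_false]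
    rfl
  | loop_false hc =>
    refine ReachesIn.single ?_
    refine (step_of_eq (hm none) _ _).trans ?_
    simp only [compile, TM2.stepAux, hc, cond_false]
    rfl
  | loop_true hc _ _ ih₁ ih₂ =>
    rw [Nat.add_comm]
    refine (ReachesIn.single ?_).trans ((ih₁ (fun l => emb (some l)) _
      fun l => hm (some l)).trans (ih₂ _ _ hm))
    refine (step_of_eq (hm none) _ _).trans ?_
    simp only [compile, TM2.stepAux, hc, cond_true]
    rfl
  | @call v ρ b k hQ =>
    obtain ⟨⟨⟨j, hj⟩, hjk⟩⟩ := hQ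
    -- Three phases: `ρ.query.length + 1` steps of transfer, at most `k` steps of the subroutine,
    -- and one step that pops the answer.
    have h1 := reachesIn_transfer hm ρ.query v ρ []
    rw [Function.update_eq_self_iff.2 rfl] at h1
    refine (h1.trans ((iterate_step_embed (f := fun l => emb (some (some l)))
      (ret := emb (some none)) (fun l => hm (some (some l))) { v with cur := none }
      { ρ with query := [] } j M.tm.main M.tm.initialState _ M.tm.initialState
      (Function.update (fun _ => []) M.tm.k₁ [M.outputAlphabet.symm b]) ?_).trans
      (ReachesIn.single ?_))).mono (by simp only at hjk; omega)
    · rw [initList_eq, Option.map_some, haltList_eq] at hj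
      rw [List.append_nil]
      rw [List.map_map] at hj
      exact hj
    · refine (step_of_eq (hm (some none)) _ _).trans ?_
      simp only [compile, TM2.stepAux]
      erw [update_stackContents_inl]
      simp only [stackContents, Function.update_self]
      erw [Function.update_idem, Function.update_eq_self_iff.2 rfl]
      have hb : (Option.map M.outputAlphabet [M.outputAlphabet.symm b].head?).getD false = b := by
        simp
      conv_rhs => rw [← hb]
      rfl
  | weaken _ hkl ih => exact (ih _ _ hm).mono hkl

end Compile

/-- The machine that runs a program and outputs a bit of its final memory. -/
def machine (M : TM2ComputableAux Bool Bool) (p : Prog) (out : Vars → Bool) :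
    TM2ComputableAux (Option Bool) Bool where
  tm :=
    { K := M.tm.K ⊕ Reg
      kDecidableEq := letI := M.tm.kDecidableEq; inferInstance
      kFin := letI := M.tm.kFin; inferInstance
      k₀ := .inr .input
      k₁ := .inl M.tm.k₁
      Γ := StackAlphabet M
      Λ := Option (Lab M p)
      main := some (entry M p)
      ΛFin := inferInstance
      σ := M.tm.σ × Vars
      initialState := (M.tm.initialState, {})
      σFin := letI := M.tm.σFin; inferInstance
      Γk₀Fin := inferInstanceAs (Fintype (Option Bool))
      m := fun l => match l with
        | some l => compile M p some none l
        | none => .push (.inl M.tm.k₁) (fun s => M.outputAlphabet.symm (out s.2))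
          (.load (fun _ => (M.tm.initialState, {})) .halt) }
  inputAlphabet := Equiv.refl (Option Bool)
  outputAlphabet := M.outputAlphabet

theorem stackContents_empty (M : TM2ComputableAux Bool Bool) :
    stackContents M (fun _ => []) {} = fun _ => [] := by
  funext k
  rcases k with k | r
  · rfl
  · cases r <;> rfl

/-- The final registers have to be empty because a halting configuration may have symbols on the
output stack only. The additional step writes the output and resets the memory. -/
theorem machine_outputs {M : TM2ComputableAux Bool Bool} {p : Prog} (out : Vars → Bool)
    {l : List (Option Bool)} {k : ℕ} {v : Vars}
    (h : Exec (Answers M) p ({}, { input := l }) k (v, {})) :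
    Nonempty (TM2OutputsInTime (machine M p out).tm
      (l.map (machine M p out).inputAlphabet.symm)
      (some [(machine M p out).outputAlphabet.symm (out v)]) (k + 1)) := by
  have h1 := h.reachesIn (m := (machine M p out).tm.m) some none fun _ => rfl
  have h2 : ReachesIn (TM2.step (machine M p out).tm.m) 1 (cfg M none (v, {}))
      (haltList (machine M p out).tm [M.outputAlphabet.symm (out v)]) := by
    refine ReachesIn.single ?_
    rw [haltList_eq]
    refine (step_of_eq (M := M) (q := .push (.inl M.tm.k₁)
      (fun s => M.outputAlphabet.symm (out s.2))
      (.load (fun _ => (M.tm.initialState, {})) .halt)) rfl _ _).trans ?_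
    simp only [TM2.stepAux]
    rw [stackContents_empty]
    rfl
  have h3 : initList (machine M p out).tm l = cfg M (some (entry M p)) ({}, { input := l }) := by
    refine (initList_eq _ _).trans ?_
    unfold cfg
    congr 1
    refine Eq.trans ?_ (update_stackContents_inr M (fun _ => []) {} .input l)
    rw [stackContents_empty]
    rfl
  have h4 : l.map (machine M p out).inputAlphabet.symm = l := List.map_id l
  obtain ⟨j, hj, h⟩ := h1.trans h2
  refine ⟨⟨⟨j, ?_⟩, hj⟩⟩
  erw [h4, h3]
  exact h

/-! ### Loops over registers -/

/-- Empty a register from the top, running `body` on each of its elements. -/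
def drain (r : Reg) (body : Prog) : Prog :=
  .seq (.pop r) (.loop (fun v => v.cur.isSome) (.seq body (.pop r)))

/-- Move the content of `r` to the top of `r'`. -/
def move (r r' : Reg) : Prog := drain r (.push r' fun v => v.cur.getD none)

/-- Run `body` on each element of `r`; the content of `r` is kept, with the help of `x`. -/
def foreach (r x : Reg) (body : Prog) : Prog :=
  .seq (drain r (.seq (.push x fun v => v.cur.getD none) body)) (move x r)

/-- Move the top element of `r` to `r'`. -/
def shift (r r' : Reg) : Prog :=
  .seq (.pop r) (.ite (fun v => v.cur.isSome) (.push r' fun v => v.cur.getD none) (.load id))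

variable {Q : List Bool → Bool → ℕ → Prop}

theorem Exec.congr {p : Prog} {a b b' : Vars × Regs} {k k' : ℕ} (h : Exec Q p a k b)
    (hb : b = b') (hk : k ≤ k') : Exec Q p a k' b' :=
  hb ▸ h.weaken hk

/-- The runs of `drain r body`. -/
inductive Drains (Q : List Bool → Bool → ℕ → Prop) (r : Reg) (body : Prog) :
    Vars × Regs → ℕ → Vars × Regs → Prop
  | nil {v ρ} : ρ.get r = [] → Drains Q r body (v, ρ) 1 ({ v with cur := none }, ρ)
  | cons {v ρ g l k a t b} : ρ.get r = g :: l →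
      Exec Q body ({ v with cur := some g }, ρ.set r l) k a → Drains Q r body a t b →
      Drains Q r body (v, ρ) (k + t + 2) b

/-- Each pass of the loop ends with a pop, so at the loop head the top of `r` is already in `cur`;
the initial state is therefore that of the run with one pop carried out. -/
theorem Drains.exec_loop {r : Reg} {body : Prog} {a b : Vars × Regs} {k : ℕ}
    (h : Drains Q r body a k b) :
    Exec Q (.loop (fun v => v.cur.isSome) (.seq body (.pop r)))
      ({ a.1 with cur := (a.2.get r).head? }, a.2.set r (a.2.get r).tail) k b := by
  induction h with
  | @nil v ρ h =>
    simp only [h, List.head?_nil, List.tail_nil]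
    rw [← h, Regs.set_get_self]
    exact .loop_false rfl
  | @cons v ρ g l k a t b h hb _ ih =>
    simp only [h, List.head?_cons, List.tail_cons]
    exact (Exec.loop_true rfl (.seq hb (.pop r a.1 a.2)) ih).weaken (by omega)

theorem Drains.exec {r : Reg} {body : Prog} {a b : Vars × Regs} {k : ℕ}
    (h : Drains Q r body a k b) : Exec Q (drain r body) a (k + 1) b :=
  (Exec.seq (.pop r a.1 a.2) h.exec_loop).weaken (by omega)

/-- The rule for loops that empty a register. -/
theorem exec_drain {r : Reg} {body : Prog} {k : ℕ} (L : List (Option Bool)) (v : ℕ → Vars)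
    (ρ : ℕ → Regs)
    (hbody : ∀ i (h : i < L.length), ∃ c,
      Exec Q body ({ v i with cur := some L[i] }, (ρ i).set r (L.drop (i + 1))) k
        ({ v (i + 1) with cur := c }, (ρ (i + 1)).set r (L.drop (i + 1)))) {c : Option (Option Bool)} :
    Exec Q (drain r body) ({ v 0 with cur := c }, (ρ 0).set r L) (L.length * (k + 2) + 2)
      ({ v L.length with cur := none }, (ρ L.length).set r []) := by
  suffices ∀ j i, i + j = L.length → ∀ c, Drains Q r body
      ({ v i with cur := c }, (ρ i).set r (L.drop i)) (j * (k + 2) + 1)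
      ({ v L.length with cur := none }, (ρ L.length).set r []) from
    (this L.length 0 (by simp) c).exec
  intro j
  induction j with
  | zero =>
    intro i hi c
    obtain rfl : i = L.length := by omega
    have := Drains.nil (Q := Q) (r := r) (body := body) (v := { v L.length with cur := c })
      (ρ := (ρ L.length).set r []) (by simp)
    simpa using this
  | succ j ih =>
    intro i hi c
    have hlt : i < L.length := by omega
    obtain ⟨c', hc'⟩ := hbody i hlt
    have h := Drains.cons (Q := Q) (r := r) (body := body) (v := { v i with cur := c })
      (ρ := (ρ i).set r (L.drop i)) (g := L[i]) (l := L.drop (i + 1))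
      (by simp) (by simpa using hc') (ih (i + 1) (by omega) c')
    have e : (j + 1) * (k + 2) + 1 = k + (j * (k + 2) + 1) + 2 := by ring
    rw [e]
    exact h

theorem exec_move {r r' : Reg} (hr : r ≠ r') (v : Vars) (ρ : Regs) :
    Exec Q (move r r') (v, ρ) (3 * (ρ.get r).length + 2)
      ({ v with cur := none }, (ρ.set r []).set r' ((ρ.get r).reverse ++ ρ.get r')) := by
  have h := exec_drain (Q := Q) (r := r) (body := .push r' fun v => v.cur.getD none) (k := 1)
    (ρ.get r) (fun _ => v) (fun i => ρ.set r' (((ρ.get r).take i).reverse ++ ρ.get r'))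
    (fun i hi => ⟨some (ρ.get r)[i], by
      refine (Exec.push ..).congr ?_ le_rfl
      simp only [Prod.mk.injEq, true_and]
      rw [Regs.get_set_of_ne _ hr.symm, Regs.get_set_self, ← Regs.set_comm _ hr.symm, Regs.set_set]
      simp [-List.take_append_getElem, List.take_add_one, List.getElem?_eq_getElem hi]⟩) (c := v.cur)
  simp only [List.take_zero, List.take_length, List.reverse_nil, List.nil_append,
    Regs.set_get_self] at h
  refine (h.congr ?_ (by omega))
  rw [Regs.set_comm _ hr.symm]

/-- An invariant rule: `v i` and `ρ i` describe the state after `i` elements. The loop itself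
changes `r` and `x`, so the body has to work for arbitrary contents `l`, `l'` of these; what it
leaves in `cur` is irrelevant since the next pop overwrites it. The element count is multiplied by
`k + 3` for the drain with its push and by `3` for moving back. -/
theorem exec_foreach {r x : Reg} (hr : r ≠ x) {body : Prog} {k : ℕ} (L : List (Option Bool))
    (v : ℕ → Vars) (ρ : ℕ → Regs)
    (hbody : ∀ i (h : i < L.length), ∀ l l', ∃ c,
      Exec Q body ({ v i with cur := some L[i] }, ((ρ i).set r l).set x l') k
        ({ v (i + 1) with cur := c }, ((ρ (i + 1)).set r l).set x l'))
    {c : Option (Option Bool)} :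
    Exec Q (foreach r x body) ({ v 0 with cur := c }, ((ρ 0).set r L).set x [])
      (L.length * (k + 6) + 4)
      ({ v L.length with cur := none }, ((ρ L.length).set r L).set x []) := by
  have h := exec_drain (Q := Q) (r := r)
    (body := .seq (.push x fun v => v.cur.getD none) body) (k := 1 + k)
    L v (fun i => (ρ i).set x (L.take i).reverse) (fun i hi => by
      obtain ⟨c, hc⟩ := hbody i hi (L.drop (i + 1)) (L.take (i + 1)).reverse
      refine ⟨c, Exec.seq (Exec.push ..) ?_⟩
      rw [← Regs.set_comm _ hr, Regs.get_set_self, Regs.set_set, ← Regs.set_comm _ hr]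
      convert hc using 4
      simp [-List.take_append_getElem, List.take_add_one, List.getElem?_eq_getElem hi]) (c := c)
  have h' := exec_move (Q := Q) hr.symm { v L.length with cur := none }
    ((((ρ L.length).set x (L.take L.length).reverse).set r []))
  simp only [List.take_zero, List.reverse_nil] at h
  rw [Regs.set_comm _ hr]
  refine (Exec.seq h h').congr ?_ ?_
  · simp only [Prod.mk.injEq, true_and]
    rw [← Regs.set_comm _ hr, Regs.get_set_self, Regs.set_set, Regs.get_set_of_ne _ hr.symm,
      Regs.get_set_self, Regs.set_comm _ hr, Regs.set_set, Regs.set_comm _ hr]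
    simp
  · rw [← Regs.set_comm _ hr, Regs.get_set_self]
    simp only [List.take_length, List.length_reverse]
    ring_nf
    omega

theorem exec_shift {r r' : Reg} (hr : r ≠ r') (v : Vars) (ρ : Regs) :
    Exec Q (shift r r') (v, ρ) 3
      ({ v with cur := (ρ.get r).head? },
        (ρ.set r (ρ.get r).tail).set r' ((ρ.get r).head?.toList ++ ρ.get r')) := by
  rcases h : ρ.get r with _ | ⟨g, l⟩
  · refine (Exec.seq (.pop r v ρ) (.ite_false (by simp [h]) (.load ..))).congr ?_ le_rfl
    simp only [h, List.tail_nil, List.head?_nil, Option.toList_none, List.nil_append, id]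
    rw [← Regs.get_set_of_ne ρ hr.symm [], Regs.set_get_self]
  · refine (Exec.seq (.pop r v ρ) (.ite_true (by simp [h]) (.push ..))).congr ?_ le_rfl
    simp [h, Regs.get_set_of_ne ρ hr.symm]

theorem exists_drop_eq_cons {α : Type*} {l : List α} {i : ℕ} (h : i < l.length) :
    ∃ g, l[i]? = some g ∧ l.drop i = g :: l.drop (i + 1) ∧ l.take (i + 1) = l.take i ++ [g] :=
  ⟨l[i], by simp, List.drop_eq_getElem_cons h, by simp⟩

theorem exec_foreach_of_eq {r x : Reg} (hr : r ≠ x) {body : Prog} {k k' : ℕ}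
    {L : List (Option Bool)} {a b : Vars × Regs} (v : ℕ → Vars) (ρ : ℕ → Regs)
    (ha : a = (v 0, ρ 0)) (hL : ∀ i, (ρ i).get r = L) (hx : ∀ i, (ρ i).get x = [])
    (hbody : ∀ i (h : i < L.length), ∀ l l', ∃ c,
      Exec Q body ({ v i with cur := some L[i] }, ((ρ i).set r l).set x l') k
        ({ v (i + 1) with cur := c }, ((ρ (i + 1)).set r l).set x l'))
    (hb : ({ v L.length with cur := none }, ρ L.length) = b)
    (hk : L.length * (k + 6) + 4 ≤ k') :
    Exec Q (foreach r x body) a k' b := by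
  have e : ∀ i, ((ρ i).set r L).set x [] = ρ i := fun i => by
    rw [← hL i, Regs.set_get_self, ← hx i, Regs.set_get_self]
  have h := exec_foreach hr L v ρ hbody (c := (v 0).cur)
  rw [e, e] at h
  exact ha ▸ h.congr hb hk

theorem exec_drain_of_eq {r : Reg} {body : Prog} {k k' : ℕ}
    {L : List (Option Bool)} {a b : Vars × Regs} (v : ℕ → Vars) (ρ : ℕ → Regs)
    (ha : a = (v 0, (ρ 0).set r L))
    (hbody : ∀ i (h : i < L.length), ∃ c,
      Exec Q body ({ v i with cur := some L[i] }, (ρ i).set r (L.drop (i + 1))) k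
        ({ v (i + 1) with cur := c }, (ρ (i + 1)).set r (L.drop (i + 1))))
    (hb : ({ v L.length with cur := none }, (ρ L.length).set r []) = b)
    (hk : L.length * (k + 2) + 2 ≤ k') :
    Exec Q (drain r body) a k' b :=
  ha ▸ (exec_drain L v ρ hbody (c := (v 0).cur)).congr hb hk

theorem exec_foreach_shift {r x a b : Reg} (hrx : r ≠ x) (hra : r ≠ a) (hrb : r ≠ b)
    (hxa : x ≠ a) (hxb : x ≠ b) (hab : a ≠ b) (v : Vars) (ρ : Regs) (hx : ρ.get x = []) :
    Exec Q (foreach r x (shift a b)) (v, ρ) (9 * (ρ.get r).length + 4)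
      ({ v with cur := none }, (ρ.set a ((ρ.get a).drop (ρ.get r).length)).set b
        (((ρ.get a).take (ρ.get r).length).reverse ++ ρ.get b)) := by
  refine exec_foreach_of_eq hrx (k := 3) (L := ρ.get r) (fun _ => v)
    (fun i => (ρ.set a ((ρ.get a).drop i)).set b (((ρ.get a).take i).reverse ++ ρ.get b))
    (by simp) (fun i => ?_) (fun i => ?_) (fun i hi l l' => ?_) ?_ (by omega)
  · rw [Regs.get_set_of_ne _ hrb, Regs.get_set_of_ne _ hra]
  · rw [Regs.get_set_of_ne _ hxb, Regs.get_set_of_ne _ hxa, hx]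
  · refine ⟨_, (exec_shift hab ..).congr (Prod.ext rfl (Regs.ext_get ?_)) le_rfl⟩
    funext y
    simp only [Regs.get_set, List.take_add_one]
    simp only [Function.update_apply]
    split_ifs <;> simp_all
    cases (ρ.get a)[i]? <;> simp
  · rfl

/-! ### Writing a query -/

/-- Write the size of the instance. -/
def writeSize : Prog :=
  .seq (foreach .low .aux (.push .query fun _ => some true))
    (.seq (foreach .high .aux (.push .query fun _ => some true)) (.push .query fun _ => some false))

/-- Write the string that encodes the set of solutions. -/
def writeSol : Prog :=
  .seq (foreach .sol .aux
    (.seq (.push .query fun _ => some true) (.push .query fun v => v.cur.getD none)))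
    (.push .query fun _ => some false)

/-- The bit in the current symbol. -/
def Vars.bit (v : Vars) : Bool := (v.cur.getD none).getD false

/-- Write a rounded coefficient. -/
def writeBlock : Prog :=
  .seq (.load fun v => { v with carry := v.ceil }) <|
  .seq (foreach .low .aux (shift .coeff .coeff2)) <|
  .seq (foreach .high .aux <|
    .seq (shift .coeff .coeff2) <|
    .seq (.push .query fun v => some (xor v.carry v.bit))
      (.load fun v => { v with carry := v.carry && v.bit })) <|
  .seq (foreach .low .aux <|
    .seq (.push .query fun v => some v.carry) (.load fun v => { v with carry := false }))
    (.load fun v => { v with carry := false })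

/-- Write all rounded coefficients. -/
def writeCoeffs : Prog :=
  .seq (foreach .size .aux2 writeBlock) (move .coeff2 .coeff)

/-- Check whether the threshold is too large for the current precision. -/
def checkThreshold : Prog :=
  .seq (foreach .low .aux (shift .thr .thr2)) <|
  .seq (foreach .high .aux (.seq (shift .thr .thr2) (shift .thr .thr2))) <|
  .seq (.pop .thr) <|
  .seq (.load fun v => { v with big := v.cur.isSome }) <|
  .seq (.ite (fun v => v.cur.isSome) (.push .thr fun v => v.cur.getD none) (.load id))
    (move .thr2 .thr)

/-- Write the rounded threshold. -/
def writeThreshold : Prog :=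
  .seq (foreach .low .aux (shift .thr .thr2)) <|
  .seq (.ite (fun v => v.big)
    (foreach .high .aux
      (.seq (.push .query fun _ => some true) (.push .query fun _ => some true)))
    (drain .thr
      (.seq (.push .thr2 fun v => v.cur.getD none) (.push .query fun v => v.cur.getD none))))
    (move .thr2 .thr)

/-! ### Correctness and cost of the programs that write a query. -/

theorem exec_foreach_push_true {r : Reg} (hr : r = .low ∨ r = .high) (v : Vars) (ρ : Regs)
    (hx : ρ.aux = []) :
    Exec Q (foreach r .aux (.push .query fun _ => some true)) (v, ρ) (7 * (ρ.get r).length + 4)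
      ({ v with cur := none },
        { ρ with query := List.replicate (ρ.get r).length (some true) ++ ρ.query }) := by
  refine exec_foreach_of_eq (k := 1) (L := ρ.get r) (by rcases hr with rfl | rfl <;> decide)
    (fun _ => v) (fun i => { ρ with query := List.replicate i (some true) ++ ρ.query })
    rfl (fun i => by rcases hr with rfl | rfl <;> rfl) (fun i => hx) (fun i hi l l' => ?_) rfl
    (by omega)
  exact ⟨some (ρ.get r)[i], (Exec.push ..).congr (by rcases hr with rfl | rfl <;> rfl) le_rfl⟩

theorem exec_writeSize (v : Vars) (ρ : Regs) (hx : ρ.aux = []) :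
    Exec Q writeSize (v, ρ) (7 * (ρ.low.length + ρ.high.length) + 9)
      ({ v with cur := none }, { ρ with
        query := some false :: (List.replicate (ρ.high.length + ρ.low.length) (some true) ++
          ρ.query) }) := by
  refine (Exec.seq (exec_foreach_push_true (.inl rfl) v ρ hx)
    (.seq (exec_foreach_push_true (.inr rfl) _ _ hx) (.push ..))).congr ?_ ?_
  · simp [Regs.set, Regs.get, ← List.append_assoc]
  · simp only [Regs.get]
    omega

theorem exec_writeSol (v : Vars) (ρ : Regs) (hx : ρ.aux = []) (s : List Bool)
    (hs : ρ.sol = s.map some) :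
    Exec Q writeSol (v, ρ) (8 * s.length + 5)
      ({ v with cur := none }, { ρ with
        query := ((s.flatMap (fun b => [true, b]) ++ [false]).map some).reverse ++ ρ.query }) := by
  have h1 : Exec Q (foreach .sol .aux
      (.seq (.push .query fun _ => some true) (.push .query fun v => v.cur.getD none)))
      (v, ρ) (8 * s.length + 4) ({ v with cur := none }, { ρ with
        query := ((s.flatMap (fun b => [true, b])).map some).reverse ++ ρ.query }) := by
    refine exec_foreach_of_eq (k := 2) (L := ρ.sol) (by decide) (fun _ => v) (fun i => { ρ with
      query := (((s.take i).flatMap (fun b => [true, b])).map some).reverse ++ ρ.query })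
      (by simp) (fun i => rfl) (fun i => hx) (fun i hi l l' => ?_) (by simp [hs])
      (by simp [hs]; omega)
    have hi' : i < s.length := by simpa [hs] using hi
    obtain ⟨g, h1, -, h2⟩ := exists_drop_eq_cons hi'
    have hg : ρ.sol[i] = some g := by
      simp only [hs, List.getElem_map]
      rw [List.getElem?_eq_getElem hi'] at h1
      exact h1
    refine ⟨some ρ.sol[i], (Exec.seq (.push ..) (.push ..)).congr (Prod.ext rfl ?_) le_rfl⟩
    simp [Regs.set, Regs.get, h2, hg]
  refine (Exec.seq h1 (.push ..)).congr ?_ le_rfl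
  simp [Regs.set, Regs.get]

/-- Addition of a carry to a little-endian number. -/
def addCarry : Bool → List Bool → List Bool
  | _, [] => []
  | c, a :: l => xor c a :: addCarry (c && a) l

/-- A carry passes only through ones, so the carry out of `l` is `c && l.all id`. Growth at the end
of the list is what the loop invariant needs, because the machine emits the least significant bit
first. -/
theorem addCarry_append_singleton (c : Bool) (l : List Bool) (a : Bool) :
    addCarry c (l ++ [a]) = addCarry c l ++ [xor (c && l.all id) a] := by
  induction l generalizing c with
  | nil => simp [addCarry]
  | cons b l ih => simp [addCarry, ih, Bool.and_assoc]

/-- The rounded coefficient: the `b` lowest bits of `l` are dropped, a carry is added, and the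
result is filled up with zeros. -/
def roundBits (c : Bool) (b : ℕ) (l : List Bool) : List Bool :=
  addCarry c (l.drop b) ++ (((c && (l.drop b).all id) :: List.replicate b false).take b)

/-- One pass skips the dropped bits, one emits the kept bits while propagating the carry, and one
emits the outgoing carry followed by zeros to refill the block. The original bits are collected in
`coeff2` so that they can be restored. -/
theorem exec_writeBlock (v : Vars) (ρ : Regs) (hx : ρ.aux = []) (l : List Bool)
    (rest : List (Option Bool)) (hl : l.length = ρ.low.length + ρ.high.length)
    (hc : ρ.coeff = l.map some ++ rest) :
    Exec Q writeBlock (v, ρ) (30 * l.length + 14)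
      ({ v with cur := none, carry := false }, { ρ with
        coeff := rest
        coeff2 := (l.map some).reverse ++ ρ.coeff2
        query := ((roundBits v.ceil ρ.low.length l).map some).reverse ++ ρ.query }) := by
  set b := ρ.low.length with hb
  set j := ρ.high.length with hj
  have h1 := exec_foreach_shift (Q := Q) (r := .low) (x := .aux) (a := .coeff) (b := .coeff2)
    (by decide) (by decide) (by decide) (by decide) (by decide) (by decide)
    { v with carry := v.ceil } ρ hx
  have hcb : ρ.coeff.drop b = (l.drop b).map some ++ rest := by
    rw [hc, List.drop_append_of_le_length (by simp; omega), List.map_drop]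
  have hcb' : ρ.coeff.take b = (l.take b).map some := by
    rw [hc, List.take_append_of_le_length (by simp; omega), List.map_take]
  set l' := l.drop b with hl'
  have hll : l'.length = j := by simp [hl', hl]
  set ρ₁ : Regs := { ρ with coeff := l'.map some ++ rest,
                            coeff2 := ((l.take b).map some).reverse ++ ρ.coeff2 } with hρ₁
  have h1' : Exec Q (foreach .low .aux (shift .coeff .coeff2)) ({ v with carry := v.ceil }, ρ)
      (9 * b + 4) ({ v with carry := v.ceil, cur := none }, ρ₁) := by
    refine h1.congr ?_ le_rfl
    simp only [Regs.set, Regs.get, ← hb, hcb, hcb', hρ₁]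
  have h2 : Exec Q (foreach .high .aux <|
      .seq (shift .coeff .coeff2) <|
      .seq (.push .query fun v => some (xor v.carry v.bit))
        (.load fun v => { v with carry := v.carry && v.bit }))
      ({ v with carry := v.ceil, cur := none }, ρ₁) (11 * j + 4)
      ({ v with carry := v.ceil && l'.all id, cur := none }, { ρ₁ with
        coeff := rest
        coeff2 := (l'.map some).reverse ++ ρ₁.coeff2
        query := ((addCarry v.ceil l').map some).reverse ++ ρ.query }) := by
    refine exec_foreach_of_eq (k := 5) (L := ρ.high) (by decide)
      (fun i => { v with carry := v.ceil && (l'.take i).all id, cur := none })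
      (fun i => { ρ₁ with
        coeff := (l'.drop i).map some ++ rest
        coeff2 := ((l'.take i).map some).reverse ++ ρ₁.coeff2
        query := ((addCarry v.ceil (l'.take i)).map some).reverse ++ ρ.query })
      (by simp [hρ₁, addCarry]) (fun i => rfl) (fun i => hx) (fun i hi m m' => ?_) ?_ ?_
    · have hi' : i < l'.length := by omega
      obtain ⟨g, -, h2, h3⟩ := exists_drop_eq_cons hi'
      refine ⟨some (some g), (Exec.seq (exec_shift (by decide) ..)
        (.seq (.push ..) (.load ..))).congr ?_ le_rfl⟩
      rw [h2, h3]
      simp [Regs.set, Regs.get, Vars.bit, addCarry_append_singleton, Bool.and_assoc]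
    · simp only [← hj, ← hll, List.take_length, List.drop_length, List.map_nil, List.nil_append]
    · rw [← hj]; omega
  set ρ₂ : Regs := { ρ₁ with
        coeff := rest
        coeff2 := (l'.map some).reverse ++ ρ₁.coeff2
        query := ((addCarry v.ceil l').map some).reverse ++ ρ.query } with hρ₂
  set c := v.ceil && l'.all id with hcdef
  have h3 : Exec Q (foreach .low .aux <|
      .seq (.push .query fun v => some v.carry) (.load fun v => { v with carry := false }))
      ({ v with carry := c, cur := none }, ρ₂) (8 * b + 4)
      -- For `b = 0` this pass is empty and the carry survives it; the final `load` of `writeBlock`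
      -- clears it.
      ({ v with carry := if b = 0 then c else false, cur := none }, { ρ₂ with
        query := (((c :: List.replicate b false).take b).map some).reverse ++ ρ₂.query }) := by
    refine exec_foreach_of_eq (k := 2) (L := ρ.low) (by decide)
      (fun i => { v with carry := if i = 0 then c else false, cur := none })
      (fun i => { ρ₂ with
        query := (((c :: List.replicate b false).take i).map some).reverse ++ ρ₂.query })
      (by simp) (fun i => rfl) (fun i => hx) (fun i hi m m' => ?_) rfl (by omega)
    refine ⟨some ρ.low[i], (Exec.seq (.push ..) (.load ..)).congr ?_ le_rfl⟩
    have hg : (c :: List.replicate b false)[i]? = some (if i = 0 then c else false) := by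
      rcases i with _ | i
      · rfl
      · have : i < b := by omega
        simp [this]
    rw [List.take_add_one, hg]
    simp [Regs.set, Regs.get]
  refine (Exec.seq (.load ..) (.seq h1' (.seq h2 (.seq h3 (.load ..))))).congr ?_ (by omega)
  simp only [hρ₂, hρ₁, Prod.mk.injEq, true_and]
  congr 1
  · rw [← List.append_assoc, ← List.reverse_append, ← List.map_append, hl', List.take_append_drop]
  · rw [roundBits, ← hl', ← hcdef]
    simp

theorem exec_writeCoeffs (v : Vars) (ρ : Regs) (hx : ρ.aux = []) (hx2 : ρ.aux2 = [])
    (hc2 : ρ.coeff2 = []) (hcarry : v.carry = false)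
    (ls : List (List Bool)) (hsize : ρ.size.length = ls.length)
    (hls : ∀ l ∈ ls, l.length = ρ.low.length + ρ.high.length)
    (hc : ρ.coeff = ls.flatten.map some) :
    Exec Q writeCoeffs (v, ρ)
      (33 * (ls.length * (ρ.low.length + ρ.high.length)) + 20 * ls.length + 6)
      ({ v with cur := none }, { ρ with
        query := ((ls.flatMap (roundBits v.ceil ρ.low.length)).map some).reverse ++ ρ.query }) := by
  set n := ρ.low.length + ρ.high.length with hn
  have hlen : ls.flatten.length = ls.length * n := by
    rw [List.length_flatten, List.map_congr_left hls]
    simp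
  have h1 : Exec Q (foreach .size .aux2 writeBlock) (v, ρ)
      (ls.length * (30 * n + 20) + 4)
      ({ v with cur := none }, { ρ with
        coeff := []
        coeff2 := (ls.flatten.map some).reverse
        query := ((ls.flatMap (roundBits v.ceil ρ.low.length)).map some).reverse ++ ρ.query }) := by
    refine exec_foreach_of_eq (k := 30 * n + 14) (L := ρ.size) (by decide)
      (fun i => v)
      (fun i => { ρ with
        coeff := (ls.drop i).flatten.map some
        coeff2 := ((ls.take i).flatten.map some).reverse
        query := (((ls.take i).flatMap (roundBits v.ceil ρ.low.length)).map some).reverse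
          ++ ρ.query })
      (by cases ρ; simp_all) (fun i => rfl) (fun i => hx2) (fun i hi m m' => ?_) ?_ ?_
    · have hi' : i < ls.length := by omega
      have hl := hls _ (List.getElem_mem hi')
      have hd := List.drop_eq_getElem_cons hi'
      have ht : ls.take (i + 1) = ls.take i ++ [ls[i]] := by simp
      have h := exec_writeBlock (Q := Q) { v with cur := some ρ.size[i] }
        { ρ with
          size := m
          aux2 := m'
          coeff := (ls.drop i).flatten.map some
          coeff2 := ((ls.take i).flatten.map some).reverse
          query := (((ls.take i).flatMap (roundBits v.ceil ρ.low.length)).map some).reverse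
            ++ ρ.query } hx ls[i] ((ls.drop (i + 1)).flatten.map some) hl
        (by simp only [hd, List.flatten_cons, List.map_append])
      refine ⟨none, h.congr ?_ (by rw [hl])⟩
      rw [ht]
      simp only [Regs.set, hcarry, List.flatten_append, List.flatMap_append, List.flatten_cons,
        List.flatten_nil, List.flatMap_cons, List.flatMap_nil, List.append_nil, List.map_append,
        List.reverse_append, List.append_assoc]
    · simp [hsize]
    · rw [hsize]
  refine (Exec.seq h1 (exec_move (by decide) ..)).congr ?_ ?_
  · cases ρ; simp_all [Regs.set, Regs.get]
  · simp only [Regs.get, List.length_reverse, List.length_map, hlen]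
    have : ls.length * (30 * n + 20) = 30 * (ls.length * n) + 20 * ls.length := by ring
    omega

/-- The only test for a remaining symbol is to pop it; this puts it back. -/
theorem exec_unpop_thr (v : Vars) (ρ : Regs) :
    Exec Q (.ite (fun v => v.cur.isSome) (.push .thr fun v => v.cur.getD none) (.load id))
      ({ v with cur := ρ.thr.head? }, { ρ with thr := ρ.thr.tail }) 2
      ({ v with cur := ρ.thr.head? }, ρ) := by
  obtain ⟨_, _, _, _, _, _, thr, _, _, _, _, _, _⟩ := ρ
  rcases thr with _ | ⟨g, l⟩
  · exact Exec.ite_false rfl (.load ..)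
  · exact Exec.ite_true rfl (.push ..)

theorem exec_checkThreshold (v : Vars) (ρ : Regs) (hx : ρ.aux = []) (ht2 : ρ.thr2 = []) :
    Exec Q checkThreshold (v, ρ)
      (9 * ρ.low.length + 12 * ρ.high.length + 3 * ρ.thr.length + 16)
      ({ v with cur := none,
                big := decide (ρ.low.length + 2 * ρ.high.length < ρ.thr.length) }, ρ) := by
  set b := ρ.low.length with hb
  set j := ρ.high.length with hj
  have h1 : Exec Q (foreach .low .aux (shift .thr .thr2)) (v, ρ) (9 * b + 4)
      ({ v with cur := none }, { ρ with
        thr := ρ.thr.drop b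
        thr2 := (ρ.thr.take b).reverse }) := by
    refine (exec_foreach_shift (by decide) (by decide) (by decide) (by decide) (by decide)
      (by decide) v ρ (by exact hx)).congr ?_ le_rfl
    simp [Regs.set, Regs.get, ht2, hb]
  have h2 : Exec Q (foreach .high .aux (.seq (shift .thr .thr2) (shift .thr .thr2)))
      ({ v with cur := none }, { ρ with
        thr := ρ.thr.drop b
        thr2 := (ρ.thr.take b).reverse }) (12 * j + 4)
      ({ v with cur := none }, { ρ with
        thr := ρ.thr.drop (b + 2 * j)
        thr2 := (ρ.thr.take (b + 2 * j)).reverse }) := by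
    refine exec_foreach_of_eq (k := 6) (L := ρ.high) (by decide) (fun _ => { v with cur := none })
      (fun i => { ρ with
        thr := ρ.thr.drop (b + 2 * i)
        thr2 := (ρ.thr.take (b + 2 * i)).reverse })
      rfl (fun i => rfl) (fun i => hx) (fun i hi l l' => ?_) rfl (by omega)
    refine ⟨_, (Exec.seq (exec_shift (by decide) ..) (exec_shift (by decide) ..)).congr
      (Prod.ext rfl ?_) le_rfl⟩
    have e : b + 2 * (i + 1) = b + 2 * i + 1 + 1 := by ring
    rw [e, List.take_add_one, List.take_add_one]
    simp only [Regs.set, Regs.get, List.head?_drop, List.tail_drop]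
    congr 1
    cases ρ.thr[b + 2 * i]? <;> cases ρ.thr[b + 2 * i + 1]? <;> simp
  set ρ₁ : Regs := { ρ with
        thr := ρ.thr.drop (b + 2 * j)
        thr2 := (ρ.thr.take (b + 2 * j)).reverse } with hρ₁
  have h3 := exec_unpop_thr (Q := Q) { v with big := ρ₁.thr.head?.isSome } ρ₁
  refine (Exec.seq h1 (.seq h2 (.seq (.pop ..) (.seq (.load ..) (.seq h3
    (exec_move (by decide) ..)))))).congr ?_ ?_
  · have e : ρ₁.thr.head?.isSome = decide (b + 2 * j < ρ.thr.length) := by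
      simp only [hρ₁, List.head?_drop]
      by_cases h : b + 2 * j < ρ.thr.length
      · simp [h]
      · simp [h]
    simp only [Regs.set, Regs.get, e]
    simp [hρ₁, ← ht2]
  · simp only [Regs.get, hρ₁, List.length_reverse, List.length_take]
    omega

theorem exec_writeThreshold (v : Vars) (ρ : Regs) (hx : ρ.aux = []) (ht2 : ρ.thr2 = []) :
    Exec Q writeThreshold (v, ρ)
      (9 * ρ.low.length + 8 * ρ.high.length + 7 * ρ.thr.length + 16)
      ({ v with cur := none }, { ρ with
        query := (if v.big then List.replicate (2 * ρ.high.length) (some true)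
          else ρ.thr.drop ρ.low.length).reverse ++ ρ.query }) := by
  set b := ρ.low.length with hb
  set j := ρ.high.length with hj
  have h1 : Exec Q (foreach .low .aux (shift .thr .thr2)) (v, ρ) (9 * b + 4)
      ({ v with cur := none }, { ρ with
        thr := ρ.thr.drop b
        thr2 := (ρ.thr.take b).reverse }) := by
    refine (exec_foreach_shift (by decide) (by decide) (by decide) (by decide) (by decide)
      (by decide) v ρ (by exact hx)).congr ?_ le_rfl
    simp [Regs.set, Regs.get, ht2, hb]
  set ρ₁ : Regs := { ρ with
        thr := ρ.thr.drop b
        thr2 := (ρ.thr.take b).reverse } with hρ₁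
  by_cases hbig : v.big = true
  · have h2 : Exec Q (foreach .high .aux
        (.seq (.push .query fun _ => some true) (.push .query fun _ => some true)))
        ({ v with cur := none }, ρ₁) (8 * j + 4) ({ v with cur := none }, { ρ₁ with
          query := List.replicate (2 * j) (some true) ++ ρ.query }) := by
      refine exec_foreach_of_eq (k := 2) (L := ρ.high) (by decide)
        (fun _ => { v with cur := none })
        (fun i => { ρ₁ with query := List.replicate (2 * i) (some true) ++ ρ.query })
        rfl (fun i => rfl) (fun i => hx) (fun i hi l l' => ?_) rfl (by omega)
      refine ⟨some ρ.high[i], (Exec.seq (.push ..) (.push ..)).congr rfl le_rfl⟩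
    refine (Exec.seq h1 (.seq (.ite_true (by exact hbig) h2)
      (exec_move (by decide) ..))).congr ?_ ?_
    · simp [Regs.set, Regs.get, hρ₁, hbig, ← ht2]
    · simp only [Regs.get, hρ₁, List.length_reverse, List.length_take]
      omega
  · have h2 : Exec Q (drain .thr
        (.seq (.push .thr2 fun v => v.cur.getD none) (.push .query fun v => v.cur.getD none)))
        ({ v with cur := none }, ρ₁) (4 * ρ.thr.length + 2) ({ v with cur := none }, { ρ₁ with
          thr := []
          thr2 := ρ.thr.reverse
          query := (ρ.thr.drop b).reverse ++ ρ.query }) := by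
      refine exec_drain_of_eq (k := 2) (L := ρ.thr.drop b)
        (fun _ => { v with cur := none })
        (fun i => { ρ₁ with
          thr2 := ((ρ.thr.drop b).take i).reverse ++ (ρ.thr.take b).reverse
          query := ((ρ.thr.drop b).take i).reverse ++ ρ.query })
        (by simp [hρ₁, Regs.set]) (fun i hi => ?_) ?_ (by simp; omega)
      · obtain ⟨g, h1, -, h2⟩ := exists_drop_eq_cons hi
        have hg : (ρ.thr.drop b)[i] = g := by
          rw [List.getElem?_eq_getElem hi] at h1
          exact Option.some.inj h1
        refine ⟨some g, (Exec.seq (.push ..) (.push ..)).congr ?_ le_rfl⟩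
        rw [h2, hg]
        simp [Regs.set, Regs.get]
      · rw [List.take_length, ← List.reverse_append, List.take_append_drop]
        rfl
    refine (Exec.seq h1 (.seq (.ite_false (by simpa using hbig) h2)
      (exec_move (by decide) ..))).congr ?_ ?_
    · simp [Regs.set, Regs.get, hρ₁, hbig, ← ht2]
    · simp only [Regs.get, List.length_reverse]
      omega

/-- Ask the subroutine for the answer to the rounded instance. -/
def ask (ceil : Bool) : Prog :=
  .seq (.load fun v => { v with ceil := ceil, carry := false }) <|
  .seq writeSize <|
  .seq writeSol <|
  .seq writeCoeffs <|
  .seq checkThreshold <|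
  .seq writeThreshold .call

/-- The registers between two queries, where `b` bits are dropped and `j` bits are kept. -/
def stageRegs (b j : ℕ) (rounds : List (Option Bool)) (s : List Bool) (ls : List (List Bool))
    (t : List Bool) : Regs :=
  { size := List.replicate (b + j) none
    rounds := rounds
    sol := s.map some
    coeff := ls.flatten.map some
    thr := t.map some
    low := List.replicate b none
    high := List.replicate j none }

/-- The query for precision `j`. -/
def stageQuery (c : Bool) (b j : ℕ) (s : List Bool) (ls : List (List Bool)) (t : List Bool) :
    List Bool :=
  (List.replicate (b + j) true ++ [false]) ++ (s.flatMap (fun b => [true, b]) ++ [false]) ++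
    ls.flatMap (roundBits c b) ++
    if b + 2 * j < t.length then List.replicate (2 * j) true else t.drop b

/-- The parsed instance has to survive a query, since the same registers serve both queries of a
round and all later rounds. -/
theorem exec_ask (c : Bool) (b j : ℕ) (R : List (Option Bool)) (s : List Bool)
    (ls : List (List Bool)) (t : List Bool) (hn : ls.length = b + j)
    (hls : ∀ l ∈ ls, l.length = b + j) (v : Vars) {ans : Bool} {k : ℕ}
    (hQ : Q (stageQuery c b j s ls t) ans k) :
    Exec Q (ask c) (v, stageRegs b j R s ls t)
      (45 * ((b + j) * (b + j)) + 60 * (b + j) + 20 * s.length + 20 * t.length + 80 +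
        (stageQuery c b j s ls t).length + k)
      ({ v with cur := none, ceil := c, carry := false, res := ans,
                big := decide (b + 2 * j < t.length) }, stageRegs b j R s ls t) := by
  set σ := stageRegs b j R s ls t
  set v₁ : Vars := { v with ceil := c, carry := false } with hv₁
  have hlow : σ.low.length = b := by simp [σ, stageRegs]
  have hhigh : σ.high.length = j := by simp [σ, stageRegs]
  have hthr : σ.thr.length = t.length := by simp [σ, stageRegs]
  have h1 := exec_writeSize (Q := Q) v₁ σ rfl
  set q₁ := some false :: (List.replicate (σ.high.length + σ.low.length) (some true) ++ σ.query)
    with hq₁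
  have h2 := exec_writeSol (Q := Q) { v₁ with cur := none } { σ with query := q₁ } rfl s rfl
  set q₂ := ((s.flatMap (fun b => [true, b]) ++ [false]).map some).reverse ++ q₁ with hq₂
  have h3 := exec_writeCoeffs (Q := Q) { v₁ with cur := none } { σ with query := q₂ }
    rfl rfl rfl rfl ls (by simp [σ, stageRegs, hn]) (by simpa [σ, stageRegs] using hls) rfl
  set q₃ := ((ls.flatMap (roundBits c σ.low.length)).map some).reverse ++ q₂ with hq₃
  have h4 := exec_checkThreshold (Q := Q) { v₁ with cur := none } { σ with query := q₃ } rfl rfl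
  set big := decide (σ.low.length + 2 * σ.high.length < σ.thr.length) with hbig
  have h5 := exec_writeThreshold (Q := Q) { v₁ with cur := none, big := big }
    { σ with query := q₃ } rfl rfl
  set q₄ := (if big then List.replicate (2 * σ.high.length) (some true)
          else σ.thr.drop σ.low.length).reverse ++ q₃ with hq₄
  have hq : q₄.reverse = (stageQuery c b j s ls t).map some := by
    simp only [hq₄, hq₃, hq₂, hq₁, hlow, hhigh, hthr, hbig, stageQuery, decide_eq_true_eq]
    have hσq : σ.query = [] := rfl
    have hσt : σ.thr = t.map some := rfl
    rw [hσq, hσt, Nat.add_comm j b]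
    split_ifs <;> simp
  have h6 : Exec Q .call ({ v₁ with cur := none, big := big }, { σ with query := q₄ })
      ((stageQuery c b j s ls t).length + k + 2)
      ({ v₁ with cur := none, big := big, res := ans }, σ) := by
    refine (Exec.call (b := ans) (k := k) ?_).congr rfl ?_
    · simp only [hq, List.map_map]
      exact (List.map_id _).symm ▸ hQ
    · have := congrArg List.length hq
      simp only [List.length_reverse, List.length_map] at this
      simp only [this]
      rfl
  refine (Exec.seq (.load ..) (.seq h1 (.seq h2 (.seq h3 (.seq h4 (.seq h5 h6)))))).congr ?_ ?_
  · simp only [hv₁, hbig, hlow, hhigh, hthr]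
  · simp only [hlow, hhigh, hthr, hn]
    omega

/-! ### Rounded instances -/

/-- The `n` lowest bits of a number. -/
def bitsN (n a : ℕ) : List Bool := List.ofFn fun j : Fin n => a.testBit j

@[simp] theorem length_bitsN (n a : ℕ) : (bitsN n a).length = n := by simp [bitsN]

theorem bitsN_succ (n a : ℕ) : bitsN (n + 1) a = a.testBit 0 :: bitsN n (a / 2) := by
  simp [bitsN, List.ofFn_succ, Nat.testBit_add_one]

theorem bitsN_add (n m a : ℕ) : bitsN (n + m) a = bitsN n a ++ bitsN m (a / 2 ^ n) := by
  induction n generalizing a with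
  | zero => simp [bitsN]
  | succ n ih =>
    rw [show n + 1 + m = n + m + 1 by ring, bitsN_succ, bitsN_succ, ih, List.cons_append,
      Nat.div_div_eq_div_mul, pow_succ']

theorem bitsN_zero_right (n : ℕ) : bitsN n 0 = List.replicate n false := by
  simp [bitsN, List.ofFn_const]

/-- Induction on the lowest bit: its outgoing carry is `c && a.testBit 0`, and `a / 2` plus this
carry is `(a + c.toNat) / 2`. The top bit on the right is the carry out of a block of ones. -/
theorem addCarry_bitsN (c : Bool) (j a : ℕ) (ha : a < 2 ^ j) :
    addCarry c (bitsN j a) ++ [c && (bitsN j a).all id] = bitsN (j + 1) (a + c.toNat) := by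
  induction j generalizing a c with
  | zero =>
    obtain rfl : a = 0 := by simpa using ha
    cases c <;> simp [bitsN, addCarry]
  | succ j ih =>
    have h2 : a / 2 < 2 ^ j := by rw [pow_succ] at ha; omega
    rw [bitsN_succ, bitsN_succ (j + 1), addCarry, List.cons_append, List.all_cons, ← Bool.and_assoc,
      id, ih _ _ h2]
    have hd : a / 2 + (c && a.testBit 0).toNat = (a + c.toNat) / 2 := by
      cases c
      · simp
      · rcases Nat.mod_two_eq_zero_or_one a with h | h <;> simp [Nat.testBit_zero, h] <;> omega
    have hx : (c ^^ a.testBit 0) = (a + c.toNat).testBit 0 := by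
      cases c
      · simp
      · rcases Nat.mod_two_eq_zero_or_one a with h | h <;> simp [Nat.testBit_zero, h] <;> omega
    rw [hd, hx]

theorem addCarry_false (l : List Bool) : addCarry false l = l := by
  induction l with
  | nil => rfl
  | cons a l ih => simp [addCarry, ih]

/-- A dropped bit makes room for the outgoing carry, hence the condition `hc`. The remaining
positions are zero because the rounded value is at most `2 ^ j`. -/
theorem roundBits_bitsN {c : Bool} {b j w : ℕ} (hw : w < 2 ^ (b + j)) (hc : c = true → 0 < b) :
    roundBits c b (bitsN (b + j) w) = bitsN (b + j) (w / 2 ^ b + c.toNat) := by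
  have hlt : w / 2 ^ b < 2 ^ j := Nat.div_lt_of_lt_mul (by rwa [← pow_add])
  have hd : (bitsN (b + j) w).drop b = bitsN j (w / 2 ^ b) := by
    rw [bitsN_add, List.drop_left' (length_bitsN _ _)]
  rw [roundBits, hd]
  rcases b with _ | b
  · have : c = false := by cases c <;> simp_all
    subst this
    simp [addCarry_false]
  · have hz : (w / 2 ^ (b + 1) + c.toNat) / 2 ^ (j + 1) = 0 := by
      refine Nat.div_eq_of_lt ?_
      have := Bool.toNat_le c
      have := pow_succ 2 j
      have : 0 < 2 ^ j := by positivity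
      omega
    have ht : ∀ x, (x :: List.replicate (b + 1) false).take (b + 1) =
        [x] ++ List.replicate b false := fun x => by simp
    rw [ht, ← List.append_assoc, addCarry_bitsN _ _ _ hlt, show b + 1 + j = j + 1 + b by ring,
      bitsN_add (j + 1) b, hz, bitsN_zero_right]

theorem bits_eq (t : ℕ) (ht : t ≠ 0) : t.bits = t.testBit 0 :: (t / 2).bits := by
  conv_lhs => rw [← Nat.bit_bodd_div2 t]
  rw [Nat.bits_append_bit _ _ (fun h => by
    have := Nat.bodd_add_div2 t
    rw [h] at this
    cases hb : t.bodd <;> simp_all)]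
  simp [Nat.div2_val, Nat.testBit_zero, Nat.mod_two_of_bodd]

theorem drop_bits (b t : ℕ) : t.bits.drop b = (t / 2 ^ b).bits := by
  induction b generalizing t with
  | zero => simp
  | succ b ih =>
    by_cases ht : t = 0
    · simp [ht]
    · rw [bits_eq t ht, List.drop_succ_cons, ih, Nat.div_div_eq_div_mul, pow_succ']

theorem replicate_true_eq_bits (m : ℕ) : List.replicate m true = (2 ^ m - 1).bits := by
  induction m with
  | zero => simp
  | succ m ih =>
    have h1 : 0 < 2 ^ m := by positivity
    have h2 : 2 ^ (m + 1) = 2 ^ m * 2 := pow_succ 2 m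
    rw [bits_eq _ (by omega), List.replicate_succ, ih]
    congr 1
    · simp
    · rw [show (2 ^ (m + 1) - 1) / 2 = 2 ^ m - 1 by omega]

theorem lt_length_bits (m t : ℕ) : m < t.bits.length ↔ 2 ^ m ≤ t := by
  rw [Nat.size_eq_bits_len, Nat.lt_size]

/-- The coefficients without their `b` lowest bits, rounded up if `c` is true. -/
def roundCoeffs {n : ℕ} (c : Bool) (b : ℕ) (w : Fin n → Fin (2 ^ n)) : Fin n → Fin (2 ^ n) :=
  fun i => ⟨(w i / 2 ^ b + c.toNat) % 2 ^ n, Nat.mod_lt _ (by positivity)⟩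

/-- The threshold without its `b` lowest bits, truncated to `2 * j` bits. -/
def roundThreshold (b j t : ℕ) : ℕ := if 2 ^ (b + 2 * j) ≤ t then 2 ^ (2 * j) - 1 else t / 2 ^ b

/-- The reduction modulo `2 ^ n` in `roundCoeffs` has no effect: a value rounded up is at most `2 ^
j`, which is below `2 ^ n` as soon as one bit is dropped. -/
theorem val_roundCoeffs {n : ℕ} {c : Bool} {b j : ℕ} (hn : b + j = n) (hc : c = true → 0 < b)
    (w : Fin n → Fin (2 ^ n)) (i : Fin n) :
    (roundCoeffs c b w i : ℕ) = w i / 2 ^ b + c.toNat := by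
  refine Nat.mod_eq_of_lt ?_
  have hw : (w i : ℕ) < 2 ^ b * 2 ^ j := by rw [← pow_add, hn]; exact (w i).2
  have hlt : (w i : ℕ) / 2 ^ b < 2 ^ j := Nat.div_lt_of_lt_mul hw
  cases c
  · exact (Nat.div_le_self _ _).trans_lt (w i).2
  · have : 2 ^ j * 2 ≤ 2 ^ n := by
      rw [← pow_succ]
      exact Nat.pow_le_pow_right (by norm_num) (by have := hc rfl; omega)
    simp only [Bool.toNat_true]
    omega

/-- This is the purpose of the truncation. The threshold of the instance may be arbitrarily large,
whereas the time of a query is controlled only if all its numbers are bounded in terms of `j`. -/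
theorem roundThreshold_lt (b j t : ℕ) : roundThreshold b j t < 2 ^ (2 * j) := by
  unfold roundThreshold
  split_ifs with h
  · exact Nat.sub_lt (by positivity) one_pos
  · exact Nat.div_lt_of_lt_mul (by rw [← pow_add]; omega)

/-- The bits of the coefficients. -/
def coeffBits {n : ℕ} (w : Fin n → Fin (2 ^ n)) : List (List Bool) :=
  List.ofFn fun i => bitsN n (w i)

theorem encodeInstance_eq (n : ℕ) (s : List Bool) (w : Fin n → Fin (2 ^ n)) (t : ℕ) :
    encodeInstance n s w t = (List.replicate n true ++ [false]) ++
      (s.flatMap (fun b => [true, b]) ++ [false]) ++ (coeffBits w).flatten ++ t.bits :=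
  rfl

/-- The query is a genuine instance of size `n` with the same string `s`, hence with the same set of
solutions, so the answers of the subroutine concern the original set. -/
theorem stageQuery_eq {n : ℕ} {c : Bool} {b j : ℕ} (hn : b + j = n) (hc : c = true → 0 < b)
    (s : List Bool) (w : Fin n → Fin (2 ^ n)) (t : ℕ) :
    stageQuery c b j s (coeffBits w) t.bits =
      encodeInstance n s (roundCoeffs c b w) (roundThreshold b j t) := by
  rw [stageQuery, encodeInstance_eq, hn]
  congr 1
  · congr 1
    rw [List.flatMap_def, coeffBits, coeffBits, List.map_ofFn]
    congr 2
    funext i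
    have hw : (w i : ℕ) < 2 ^ (b + j) := hn ▸ (w i).2
    simp only [Function.comp, val_roundCoeffs hn hc]
    have h := roundBits_bitsN hw hc
    rwa [hn] at h
  · simp only [lt_length_bits, roundThreshold]
    split_ifs
    · exact replicate_true_eq_bits _
    · exact drop_bits _ _

theorem length_encodeInstance (n : ℕ) (s : List Bool) (w : Fin n → Fin (2 ^ n)) (t : ℕ) :
    (encodeInstance n s w t).length = n + 1 + (2 * s.length + 1) + n * n + t.bits.length := by
  have h : ∀ l ∈ coeffBits w, l.length = n := by
    intro l hl
    obtain ⟨i, rfl⟩ := (List.mem_ofFn' _ _).1 hl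
    simp
  have h2 : (coeffBits w).flatten.length = n * n := by
    rw [List.length_flatten, List.map_congr_left h]
    simp [coeffBits, Function.comp_def]
  have h3 : (s.flatMap (fun b => [true, b])).length = 2 * s.length := by
    simp [List.length_flatMap, mul_comm]
  rw [encodeInstance_eq]
  simp only [List.length_append, h2, h3]
  simp

/-! ### Increasing the precision until the rounded instances determine the answer -/

/-- Try to find the answer with the current precision. -/
def decideRound : Prog :=
  .seq (ask false) <|
  -- Rounding down lowers the weights, so "no" is conclusive, unless the threshold was lowered too
  -- by truncation.
  .ite (fun v => !v.res && !v.big) (.load fun v => { v with ans := some false }) <|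
  .seq (ask true) <|
  -- Here "yes" is conclusive even for a truncated threshold, since truncation only makes the
  -- instance harder to satisfy.
  .ite (fun v => v.res) (.load fun v => { v with ans := some true }) (.load id)

/-- Solve a parsed instance. -/
def solve : Prog :=
  -- At precision `0` all coefficients and the threshold are `0`, so this query tests whether there
  -- is any solution.
  .seq (ask false) <|
  .seq (.ite (fun v => v.res) (.load id) (.load fun v => { v with ans := some false })) <|
  .seq (drain .rounds
    (.seq (.ite (fun v => v.ans.isNone) decideRound (.load id)) (shift .low .high))) <|
  .ite (fun v => v.ans.isNone) (.seq (ask false) (.load fun v => { v with ans := some v.res }))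
    (.load id)

/-- The answer that is known before the round with precision `j`, when `F`, `G` and `B` are the
results of the queries with coefficients rounded down and up and of the test of the threshold. -/
def knownAnswer (F G B : ℕ → Bool) : ℕ → Option Bool
  | 0 => if F 0 then none else some false
  | j + 1 => match knownAnswer F G B j with
    | some a => some a
    | none => if !F j && !B j then some false else if G j then some true else none

theorem exec_decideRound {F G B : ℕ → Bool} {K : ℕ → ℕ} {j : ℕ} {ρ : Regs}
    (hF : ∀ v : Vars, Exec Q (ask false) (v, ρ) (K j)
      ({ v with cur := none, ceil := false, carry := false, res := F j, big := B j }, ρ))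
    (hG : ∀ v : Vars, Exec Q (ask true) (v, ρ) (K j)
      ({ v with cur := none, ceil := true, carry := false, res := G j, big := B j }, ρ))
    (v : Vars) (h : knownAnswer F G B j = none) (hv : v.ans = none) :
    ∃ v' : Vars, Exec Q decideRound (v, ρ) (2 * K j + 3) (v', ρ) ∧
      v'.ans = knownAnswer F G B (j + 1) := by
  simp only [knownAnswer, h]
  by_cases h1 : (!F j && !B j) = true
  · exact ⟨_, (Exec.seq (hF v) (.ite_true h1 (.load ..))).weaken (by omega), by simp [h1]⟩
  · by_cases h2 : G j = true
    · exact ⟨_, (Exec.seq (hF v) (.ite_false (by simpa using h1) (.seq (hG _)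
        (.ite_true h2 (.load ..))))).weaken (by omega), by simp [h1, h2]⟩
    · exact ⟨_, (Exec.seq (hF v) (.ite_false (by simpa using h1) (.seq (hG _)
        (.ite_false (by simpa using h2) (.load ..))))).weaken (by omega), by simp [h1, h2, hv]⟩

/-- The number of rounds is fixed by the register `rounds`, but a round that begins with a known
answer has constant cost. The indicator in the sum is what later turns into a probability. -/
theorem drains_rounds {F G B : ℕ → Bool} {K : ℕ → ℕ} {n : ℕ} {s : List Bool}
    {ls : List (List Bool)} {t : List Bool}
    (hF : ∀ b j R, b + j = n → ∀ v : Vars, Exec Q (ask false) (v, stageRegs b j R s ls t) (K j)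
      ({ v with cur := none, ceil := false, carry := false, res := F j, big := B j },
        stageRegs b j R s ls t))
    (hG : ∀ b j R, b + j = n → 0 < b → ∀ v : Vars,
      Exec Q (ask true) (v, stageRegs b j R s ls t) (K j)
      ({ v with cur := none, ceil := true, carry := false, res := G j, big := B j },
        stageRegs b j R s ls t))
    (b j : ℕ) (hn : b + j = n) (v : Vars) (hv : v.ans = knownAnswer F G B j) :
    ∃ v' : Vars, Drains Q .rounds
      (.seq (.ite (fun v => v.ans.isNone) decideRound (.load id)) (shift .low .high))
      (v, stageRegs b j (List.replicate b none) s ls t)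
      (∑ i ∈ Finset.Ico j n, ((if knownAnswer F G B i = none then 2 * K i else 0) + 9) + 1)
      (v', stageRegs 0 n [] s ls t) ∧ v'.ans = knownAnswer F G B n := by
  induction b generalizing j v with
  | zero =>
    obtain rfl : j = n := by omega
    exact ⟨{ v with cur := none }, by
      simpa using Drains.nil (r := .rounds) (v := v) (ρ := stageRegs 0 j [] s ls t) rfl, hv⟩
  | succ b ih =>
    set ρ := stageRegs (b + 1) j (List.replicate b none) s ls t
    obtain ⟨v₁, h₁, hv₁⟩ : ∃ v' : Vars, Exec Q
        (.ite (fun v => v.ans.isNone) decideRound (.load id)) ({ v with cur := some none }, ρ)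
        ((if knownAnswer F G B j = none then 2 * K j else 0) + 4) (v', ρ) ∧
        v'.ans = knownAnswer F G B (j + 1) := by
      rcases h : knownAnswer F G B j with _ | a
      · obtain ⟨v', h1, h2⟩ := exec_decideRound (hF (b + 1) j _ hn)
          (hG (b + 1) j _ hn (Nat.succ_pos b)) { v with cur := some none } h (hv.trans h)
        refine ⟨v', ((Exec.ite_true ?_ h1)).weaken (by simp), h2⟩
        simp [hv, h]
      · refine ⟨_, (Exec.ite_false ?_ (.load ..)).weaken (by simp), ?_⟩
        · simp [hv, h]
        · simp [knownAnswer, h, hv]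
    have h₂ := exec_shift (Q := Q) (r := .low) (r' := .high) (by decide) v₁ ρ
    obtain ⟨v', h', hv'⟩ := ih (j + 1) (by omega) { v₁ with cur := (ρ.get .low).head? } hv₁
    refine ⟨v', ?_, hv'⟩
    rw [Finset.sum_eq_sum_Ico_succ_bot (by omega)]
    have e : (ρ.set .low (ρ.get .low).tail).set .high ((ρ.get .low).head?.toList ++ ρ.get .high) =
        stageRegs b (j + 1) (List.replicate b none) s ls t := by
      simp [ρ, stageRegs, Regs.set, Regs.get, List.replicate_succ, Nat.add_right_comm, Nat.add_assoc]
    rw [e] at h₂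
    have h3 := Drains.cons (r := .rounds)
      (ρ := stageRegs (b + 1) j (List.replicate (b + 1) none) s ls t) (v := v)
      (g := none) (l := List.replicate b none) rfl (h₁.seq h₂) h'
    convert h3 using 1
    ring

/-- The separate `K 0` pays for the initial query; the summand `i = n` pays for the last one, in
which nothing is rounded. -/
theorem exec_solve {F G B : ℕ → Bool} {K : ℕ → ℕ} {n : ℕ} {s : List Bool}
    {ls : List (List Bool)} {t : List Bool}
    (hF : ∀ b j R, b + j = n → ∀ v : Vars, Exec Q (ask false) (v, stageRegs b j R s ls t) (K j)
      ({ v with cur := none, ceil := false, carry := false, res := F j, big := B j },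
        stageRegs b j R s ls t))
    (hG : ∀ b j R, b + j = n → 0 < b → ∀ v : Vars,
      Exec Q (ask true) (v, stageRegs b j R s ls t) (K j)
      ({ v with cur := none, ceil := true, carry := false, res := G j, big := B j },
        stageRegs b j R s ls t))
    (v : Vars) (hv : v.ans = none) :
    ∃ v' : Vars, Exec Q solve (v, stageRegs n 0 (List.replicate n none) s ls t)
      (K 0 + ∑ i ∈ Finset.range (n + 1), ((if knownAnswer F G B i = none then 2 * K i else 0) + 9))
      (v', stageRegs 0 n [] s ls t) ∧ v'.ans = some ((knownAnswer F G B n).getD (F n)) := by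
  obtain ⟨v₁, h₁, hv₁⟩ : ∃ v' : Vars, Exec Q
      (.ite (fun v => v.res) (.load id) (.load fun v => { v with ans := some false }))
      ({ v with cur := none, ceil := false, carry := false, res := F 0, big := B 0 },
        stageRegs n 0 (List.replicate n none) s ls t) 2
      (v', stageRegs n 0 (List.replicate n none) s ls t) ∧ v'.ans = knownAnswer F G B 0 := by
    by_cases h : F 0 = true
    · exact ⟨_, Exec.ite_true h (.load ..), by simp [knownAnswer, h, hv]⟩
    · exact ⟨_, Exec.ite_false (by simpa using h) (.load ..), by simp [knownAnswer, h]⟩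
  obtain ⟨v₂, h₂, hv₂⟩ := drains_rounds hF hG n 0 (by omega) v₁ hv₁
  obtain ⟨v₃, h₃, hv₃⟩ : ∃ v' : Vars, Exec Q
      (.ite (fun v => v.ans.isNone) (.seq (ask false) (.load fun v => { v with ans := some v.res }))
        (.load id)) (v₂, stageRegs 0 n [] s ls t)
      ((if knownAnswer F G B n = none then 2 * K n else 0) + 2)
      (v', stageRegs 0 n [] s ls t) ∧ v'.ans = some ((knownAnswer F G B n).getD (F n)) := by
    rcases h : knownAnswer F G B n with _ | a
    · refine ⟨_, (Exec.ite_true ?_ (.seq (hF 0 n [] (by omega) v₂) (.load ..))).weaken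
        (by simp; omega), rfl⟩
      simp [hv₂, h]
    · refine ⟨_, (Exec.ite_false ?_ (.load ..)).weaken (by simp), ?_⟩
      · simp [hv₂, h]
      · simp [hv₂, h]
  refine ⟨v₃, ((hF n 0 _ (by omega) v).seq (h₁.seq (h₂.exec.seq h₃))).weaken ?_, hv₃⟩
  rw [Finset.sum_range_succ, Finset.range_eq_Ico]
  omega

/-! ### Reading the input -/

/-- Read the size of the instance. -/
def readSize : Prog :=
  .seq (.pop .input) <|
  .seq (.loop (fun v => v.cur == some (some true))
    (.seq (.push .size fun _ => none) (.seq (.push .rounds fun _ => none)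
      (.seq (.push .low fun _ => none) (.pop .input)))))
    (.load fun v => { v with valid := v.cur == some (some false) })

/-- The loop of `readSol`. -/
def readSolLoop : Prog :=
  .loop (fun v => v.cur == some (some true)) <| .seq (.pop .input) <|
    .ite (fun v => (v.cur.getD none).isSome)
      (.seq (.push .aux fun v => v.cur.getD none) (.pop .input))
      (.load fun v => { v with cur := none })

/-- Read the string that encodes the set of solutions. -/
def readSol : Prog :=
  .seq (.pop .input) <| .seq readSolLoop <|
  .seq (.load fun v => { v with valid := v.cur == some (some false) }) (move .aux .sol)

/-- Read the coefficients. -/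
def readCoeffs : Prog :=
  .seq (foreach .size .aux2 <| foreach .low .aux <| .seq (.pop .input) <|
    .seq (.push .coeff2 fun v => v.cur.getD none)
      (.load fun v => { v with valid := v.valid && (v.cur.getD none).isSome }))
    (move .coeff2 .coeff)

/-- Read the threshold. -/
def readThreshold : Prog :=
  .seq (.load fun v => { v with carry := true }) <|
  .seq (.pop .input) <|
  .seq (.loop (fun v => (v.cur.getD none).isSome) <|
    .seq (.push .thr2 fun v => v.cur.getD none) <|
    .seq (.load fun v => { v with carry := v.bit }) (.pop .input)) <|
  .seq (.load fun v => { v with valid := v.carry }) (move .thr2 .thr)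

/-! ### Correctness and cost of the parser. -/

theorem exec_readSize (n : ℕ) (g : Option Bool) (hg : g ≠ some true) (l : List (Option Bool))
    (v : Vars) :
    Exec Q readSize (v, { input := List.replicate n (some true) ++ g :: l }) (5 * n + 3)
      ({ v with cur := some g, valid := g == some false },
        { input := l, size := List.replicate n none, rounds := List.replicate n none,
          low := List.replicate n none }) := by
  have hloop : ∀ (n m : ℕ) (v : Vars),
      Exec Q (.loop (fun v => v.cur == some (some true))
        (.seq (.push .size fun _ => none) (.seq (.push .rounds fun _ => none)
          (.seq (.push .low fun _ => none) (.pop .input)))))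
        ({ v with cur := (List.replicate n (some true) ++ g :: l).head? },
          { input := (List.replicate n (some true) ++ g :: l).tail,
            size := List.replicate m none, rounds := List.replicate m none,
            low := List.replicate m none }) (5 * n + 1)
        ({ v with cur := some g },
          { input := l, size := List.replicate (m + n) none,
            rounds := List.replicate (m + n) none, low := List.replicate (m + n) none }) := by
    intro n
    induction n with
    | zero =>
      intro m v
      exact .loop_false (by simpa using hg)
    | succ n ih =>
      intro m v
      have h := ih (m + 1) v
      rw [show m + 1 + n = m + (n + 1) by ring] at h
      exact (Exec.loop_true rfl (.seq (.push ..) (.seq (.push ..) (.seq (.push ..) (.pop ..))))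
        h).weaken (by omega)
  have h := hloop n 0 v
  rw [Nat.zero_add] at h
  refine (Exec.seq (.pop ..) (h.seq (.load ..))).congr ?_ (by omega)
  simp

/-- The continuation at `m` is left open, so that one induction serves well-formed strings and both
ways in which the string can break off. -/
theorem exec_readSolLoop (s : List Bool) (m : List (Option Bool)) (ρ : Regs) (v : Vars) (k : ℕ)
    (b : Vars × Regs)
    (h : Exec Q readSolLoop ({ v with cur := m.head? },
      { ρ with input := m.tail, aux := (s.map some).reverse ++ ρ.aux }) k b) :
    Exec Q readSolLoop
      ({ v with cur := ((s.flatMap (fun b => [true, b])).map some ++ m).head? },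
        { ρ with input := ((s.flatMap (fun b => [true, b])).map some ++ m).tail })
      (5 * s.length + k) b := by
  induction s generalizing ρ with
  | nil => simpa using h
  | cons a s ih =>
    have h1 := ih { ρ with aux := some a :: ρ.aux } (by simpa using h)
    exact (Exec.loop_true rfl (.seq (.pop ..) (.ite_true rfl (.seq (.push ..) (.pop ..)))) h1).weaken
      (by simp; omega)

theorem exec_readSol (s : List Bool) (l : List (Option Bool)) (ρ : Regs) (hx : ρ.aux = [])
    (hs : ρ.sol = [])
    (hin : ρ.input = (s.flatMap (fun b => [true, b]) ++ [false]).map some ++ l) (v : Vars) :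
    Exec Q readSol (v, ρ) (8 * s.length + 5)
      ({ v with cur := none, valid := true }, { ρ with input := l, sol := s.map some }) := by
  have h := exec_readSolLoop (Q := Q) s (some false :: l) ρ v 1 _ (.loop_false rfl)
  have hin' : ρ.input = (s.flatMap (fun b => [true, b])).map some ++ some false :: l := by
    simp [hin]
  rw [← hin'] at h
  refine (Exec.seq (.pop ..) (h.seq (.seq (.load ..) (exec_move (by decide) ..)))).congr ?_ ?_
  · simp [Regs.set, Regs.get, hx, hs]
  · simp [Regs.get, hx]
    omega

theorem exec_readSol_invalid (s : List Bool) (m l : List (Option Bool))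
    (hm : m = none :: l ∨ m = some true :: none :: l) (ρ : Regs)
    (hin : ρ.input = (s.flatMap (fun b => [true, b])).map some ++ m) (v : Vars) :
    ∃ k v' ρ', Exec Q readSol (v, ρ) k (v', ρ') ∧ v'.valid = false ∧ v'.ans = v.ans := by
  obtain ⟨k, v₁, ρ₁, h, hv, ha⟩ : ∃ k v' ρ', Exec Q readSolLoop ({ v with cur := m.head? },
      { ρ with input := m.tail, aux := (s.map some).reverse ++ ρ.aux }) k (v', ρ') ∧
      (v'.cur == some (some false)) = false ∧ v'.ans = v.ans := by
    rcases hm with rfl | rfl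
    · exact ⟨_, _, _, .loop_false rfl, rfl, rfl⟩
    · exact ⟨_, _, _, .loop_true rfl (.seq (.pop ..) (.ite_false rfl (.load ..)))
        (.loop_false rfl), rfl, rfl⟩
  have h := exec_readSolLoop s m ρ v k _ h
  rw [← hin] at h
  exact ⟨_, _, _, .seq (.pop ..) (h.seq (.seq (.load ..) (exec_move (by decide) ..))), hv, ha⟩

/-- `m[k]?.getD none` is `none` at a separator as well as beyond the end, so the loop can always run
`n * n` times and `valid` records whether all symbols were bits. -/
theorem exec_readCoeffs (v : Vars) (ρ : Regs) (m : List (Option Bool)) (n : ℕ)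
    (hin : ρ.input = m) (hsize : ρ.size.length = n) (hlow : ρ.low.length = n)
    (hx : ρ.aux = []) (hx2 : ρ.aux2 = []) (hc : ρ.coeff = []) (hc2 : ρ.coeff2 = []) :
    Exec Q readCoeffs (v, ρ) (12 * (n * n) + 10 * n + 6)
      ({ v with cur := none, valid := v.valid &&
        (List.range (n * n)).all fun k => (m[k]?.getD none).isSome }, { ρ with
        input := m.drop (n * n)
        coeff := (List.range (n * n)).map fun k => m[k]?.getD none }) := by
  set f : ℕ → Option Bool := fun k => m[k]?.getD none with hf
  have hinner : ∀ (p : ℕ) (v : Vars) (ρ : Regs), ρ.aux = [] → ρ.low.length = n →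
      Exec Q (foreach .low .aux <| .seq (.pop .input) <|
        .seq (.push .coeff2 fun v => v.cur.getD none)
        (.load fun v => { v with valid := v.valid && (v.cur.getD none).isSome }))
      ({ v with valid := v.valid && (List.range p).all fun k => (f k).isSome }, { ρ with
        input := m.drop p
        coeff2 := ((List.range p).map f).reverse }) (n * 9 + 4)
      ({ v with cur := none,
                valid := v.valid && (List.range (p + n)).all fun k => (f k).isSome }, { ρ with
        input := m.drop (p + n)
        coeff2 := ((List.range (p + n)).map f).reverse }) := by
    intro p v ρ hx hlow
    refine exec_foreach_of_eq (k := 3) (L := ρ.low) (by decide)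
      (fun i => { v with valid := v.valid && (List.range (p + i)).all fun k => (f k).isSome })
      (fun i => { ρ with
        input := m.drop (p + i)
        coeff2 := ((List.range (p + i)).map f).reverse })
      rfl (fun i => rfl) (fun i => hx) (fun i hi l l' => ?_) (by simp only [hlow]) (by rw [hlow])
    refine ⟨(m.drop (p + i)).head?, (Exec.seq (.pop ..) (.seq (.push ..) (.load ..))).congr ?_
      le_rfl⟩
    rw [← Nat.add_assoc, List.range_succ]
    simp [Regs.set, Regs.get, hf, Bool.and_assoc]
  have h1 : Exec Q (foreach .size .aux2 <| foreach .low .aux <| .seq (.pop .input) <|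
      .seq (.push .coeff2 fun v => v.cur.getD none)
        (.load fun v => { v with valid := v.valid && (v.cur.getD none).isSome })) (v, ρ)
      (n * (n * 9 + 10) + 4)
      ({ v with cur := none,
                valid := v.valid && (List.range (n * n)).all fun k => (f k).isSome }, { ρ with
        input := m.drop (n * n)
        coeff2 := ((List.range (n * n)).map f).reverse }) := by
    refine exec_foreach_of_eq (k := n * 9 + 4) (L := ρ.size) (by decide)
      (fun i => { v with valid := v.valid && (List.range (i * n)).all fun k => (f k).isSome })
      (fun i => { ρ with
        input := m.drop (i * n)
        coeff2 := ((List.range (i * n)).map f).reverse })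
      (by cases ρ; simp_all) (fun i => rfl) (fun i => hx2) (fun i hi l l' => ?_)
      (by simp only [hsize]) (by rw [hsize])
    refine ⟨none, ?_⟩
    have h := hinner (i * n) { v with cur := some ρ.size[i] } { ρ with size := l, aux2 := l' } hx hlow
    rw [show (i + 1) * n = i * n + n by ring]
    exact h
  refine (h1.seq (exec_move (by decide) ..)).congr ?_ ?_
  · simp [Regs.set, Regs.get, hc, hc2, hf]
  · simp only [Regs.get, List.length_reverse, List.length_map, List.length_range]
    have : n * (n * 9 + 10) = 9 * (n * n) + 10 * n := by ring
    omega

/-- A bit string is the expansion of a number iff it is empty or its most significant bit is `true`.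
The last bit read is kept in `carry`, and the default `true` accepts the empty expansion of `0`. -/
theorem exec_readThreshold (v : Vars) (ρ : Regs) (t : List Bool) (l : List (Option Bool))
    (hin : ρ.input = t.map some ++ none :: l) (ht : ρ.thr = []) (ht2 : ρ.thr2 = []) :
    Exec Q readThreshold (v, ρ) (7 * t.length + 7)
      ({ v with cur := none, carry := t.getLast?.getD true, valid := t.getLast?.getD true },
        { ρ with input := l, thr := t.map some }) := by
  have hloop : ∀ (t : List Bool) (v : Vars) (ρ : Regs),
      Exec Q (.loop (fun v => (v.cur.getD none).isSome) <|
        .seq (.push .thr2 fun v => v.cur.getD none) <|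
        .seq (.load fun v => { v with carry := v.bit }) (.pop .input))
        ({ v with cur := (t.map some ++ none :: l).head? },
          { ρ with input := (t.map some ++ none :: l).tail }) (4 * t.length + 1)
        ({ v with cur := some none, carry := t.getLast?.getD v.carry },
          { ρ with input := l, thr2 := (t.map some).reverse ++ ρ.thr2 }) := by
    intro t
    induction t with
    | nil => exact fun v ρ => .loop_false rfl
    | cons a t ih =>
      intro v ρ
      have h := ih { v with carry := a } { ρ with thr2 := some a :: ρ.thr2 }
      refine (Exec.loop_true rfl (.seq (.push ..) (.seq (.load ..) (.pop ..))) h).congr ?_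
        (by simp; omega)
      simp [List.getLast?_cons]
  have h := hloop t { v with carry := true } ρ
  rw [← hin] at h
  refine (Exec.seq (.load ..) (.seq (.pop ..) (h.seq (.seq (.load ..)
    (exec_move (by decide) ..))))).congr ?_ ?_
  · simp [Regs.set, Regs.get, ht, ht2]
  · simp [Regs.get, ht2]
    omega

/-- Empty a register. -/
def clear (r : Reg) : Prog := drain r (.load id)

theorem exec_clear (r : Reg) (v : Vars) (ρ : Regs) :
    Exec Q (clear r) (v, ρ) (3 * (ρ.get r).length + 2) ({ v with cur := none }, ρ.set r []) :=
  exec_drain_of_eq (k := 1) (L := ρ.get r) (fun _ => v) (fun _ => ρ) (by simp)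
    (fun i _ => ⟨some (ρ.get r)[i], .load ..⟩) rfl (by omega)

/-- Empty a list of registers. -/
def clearList : List Reg → Prog
  | [] => .load fun v => { v with cur := none }
  | r :: l => .seq (clear r) (clearList l)

/-- The total length of the registers in a list. -/
def Regs.total (ρ : Regs) (l : List Reg) : ℕ := (l.map fun r => (ρ.get r).length).sum

theorem exec_clearList (l : List Reg) (v : Vars) (ρ : Regs) :
    Exec Q (clearList l) (v, ρ) (3 * ρ.total l + 2 * l.length + 1)
      ({ v with cur := none }, l.foldl (fun ρ r => ρ.set r []) ρ) := by
  induction l generalizing v ρ with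
  | nil => exact .load ..
  | cons r l ih =>
    refine ((exec_clear r v ρ).seq (ih _ _)).congr rfl ?_
    have h : (ρ.set r []).total l ≤ ρ.total l := by
      refine List.sum_le_sum fun r' _ => ?_
      rw [Regs.get_set, Function.update_apply]
      split_ifs <;> simp
    simp only [Regs.total, List.map_cons, List.sum_cons, List.length_cons] at h ⊢
    omega

/-- All registers. -/
def allRegs : List Reg :=
  [.input, .size, .rounds, .sol, .coeff, .coeff2, .thr, .thr2, .low, .high, .query, .aux, .aux2]

/-- The program that decides the language of a binary decision problem. -/
def mainProg : Prog :=
  .seq (.seq readSize <| .ite (fun v => v.valid)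
    (.seq readSol <| .ite (fun v => v.valid)
      (.seq readCoeffs <| .ite (fun v => v.valid)
        (.seq readThreshold <| .seq (clear .input) <| .ite (fun v => v.valid) solve (.load id))
        (.load id))
      (.load id))
    (.load id))
    (clearList allRegs)

theorem exec_seq_clear {p : Prog} {a : Vars × Regs} {k : ℕ} {v : Vars} {ρ : Regs}
    (h : Exec Q p a k (v, ρ)) :
    Exec Q (.seq p (clearList allRegs)) a (k + (3 * ρ.total allRegs + 27))
      ({ v with cur := none }, {}) :=
  h.seq (exec_clearList allRegs v ρ)

/-! ### Encodings of instances -/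

theorem exists_bitsN_eq (n : ℕ) (l : List Bool) (hl : l.length = n) :
    ∃ a : Fin (2 ^ n), bitsN n a = l := by
  induction n generalizing l with
  | zero => exact ⟨0, by simp_all [bitsN]⟩
  | succ n ih =>
    rcases l with _ | ⟨b, l⟩
    · simp at hl
    · obtain ⟨a, rfl⟩ := ih l (by simpa using hl)
      have hb := Bool.toNat_le b
      refine ⟨⟨2 * a + b.toNat, by have := a.2; rw [pow_succ]; omega⟩, ?_⟩
      rw [bitsN_succ]
      have h2 : (2 * (a : ℕ) + b.toNat) / 2 = a := by omega
      simp only [h2, Nat.testBit_zero]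
      cases b <;> simp

theorem exists_flatten_bitsN_eq (m n : ℕ) (l : List Bool) (hl : l.length = m * n) :
    ∃ w : Fin m → Fin (2 ^ n), (List.ofFn fun i => bitsN n (w i)).flatten = l := by
  induction m generalizing l with
  | zero => exact ⟨Fin.elim0, by simp_all⟩
  | succ m ih =>
    rw [Nat.succ_mul] at hl
    obtain ⟨a, ha⟩ := exists_bitsN_eq n (l.take n) (by simp; omega)
    obtain ⟨w, hw⟩ := ih (l.drop n) (by simp; omega)
    refine ⟨Fin.cons a w, ?_⟩
    rw [List.ofFn_succ]
    simp [ha, hw]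

theorem getLast?_bits (t : ℕ) : t.bits.getLast?.getD true = true := by
  induction t using Nat.strong_induction_on with
  | _ t ih =>
    by_cases ht : t = 0
    · simp [ht]
    · rw [bits_eq t ht, List.getLast?_cons]
      by_cases h : t / 2 = 0
      · obtain rfl : t = 1 := by omega
        simp
      · have h1 := ih (t / 2) (by omega)
        rw [bits_eq _ h, List.getLast?_cons] at h1 ⊢
        simpa using h1

theorem exists_bits_eq (l : List Bool) (hl : l.getLast?.getD true = true) :
    ∃ t : ℕ, t.bits = l := by
  induction l with
  | nil => exact ⟨0, by simp⟩
  | cons a l ih =>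
    rcases l with _ | ⟨b, l⟩
    · simp only [List.getLast?_singleton, Option.getD_some] at hl
      exact ⟨1, by simp [hl]⟩
    · obtain ⟨t, ht⟩ := ih (by simpa [List.getLast?_cons] using hl)
      refine ⟨Nat.bit a t, ?_⟩
      rw [Nat.bits_append_bit, ht]
      rintro rfl
      simp at ht

/-- This case distinction and `eq_flatMap_or` mirror the parser: every alternative but the last is a
point at which parsing fails. -/
theorem eq_replicate_true_or (y : List Bool) :
    ∃ n, y = List.replicate n true ∨ ∃ y', y = List.replicate n true ++ false :: y' := by
  induction y with
  | nil => exact ⟨0, .inl rfl⟩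
  | cons a y ih =>
    cases a
    · exact ⟨0, .inr ⟨y, rfl⟩⟩
    · obtain ⟨n, rfl | ⟨y', rfl⟩⟩ := ih
      · exact ⟨n + 1, .inl rfl⟩
      · exact ⟨n + 1, .inr ⟨y', rfl⟩⟩

theorem eq_flatMap_or : ∀ y : List Bool, ∃ s : List Bool,
    y = s.flatMap (fun b => [true, b]) ∨ y = s.flatMap (fun b => [true, b]) ++ [true] ∨
      ∃ y', y = (s.flatMap (fun b => [true, b]) ++ [false]) ++ y'
  | [] => ⟨[], .inl rfl⟩
  | [true] => ⟨[], .inr (.inl rfl)⟩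
  | false :: y => ⟨[], .inr (.inr ⟨y, rfl⟩)⟩
  | true :: b :: y => by
    obtain ⟨s, rfl | rfl | ⟨y', rfl⟩⟩ := eq_flatMap_or y
    · exact ⟨b :: s, .inl rfl⟩
    · exact ⟨b :: s, .inr (.inl rfl)⟩
    · exact ⟨b :: s, .inr (.inr ⟨y', rfl⟩)⟩

theorem replicate_true_append_inj {m n : ℕ} {y y' : List Bool}
    (h : List.replicate m true ++ false :: y = List.replicate n true ++ false :: y') :
    m = n ∧ y = y' := by
  induction m generalizing n with
  | zero =>
    cases n
    · simpa using h
    · simp [List.replicate_succ] at h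
  | succ m ih =>
    cases n
    · simp [List.replicate_succ] at h
    · simp only [List.replicate_succ, List.cons_append, List.cons.injEq, true_and] at h
      simpa using ih h

theorem flatMap_append_inj {s s' : List Bool} {y y' : List Bool}
    (h : s.flatMap (fun b => [true, b]) ++ false :: y =
      s'.flatMap (fun b => [true, b]) ++ false :: y') : s = s' ∧ y = y' := by
  induction s generalizing s' with
  | nil =>
    cases s'
    · simpa using h
    · simp at h
  | cons a s ih =>
    cases s'
    · simp at h
    · simp only [List.flatMap_cons, List.cons_append, List.nil_append, List.cons.injEq,
        true_and] at h
      simpa [h.1] using ih h.2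

theorem bitsN_inj {n : ℕ} {a b : Fin (2 ^ n)} (h : bitsN n a = bitsN n b) : a = b := by
  refine Fin.ext (Nat.eq_of_testBit_eq fun i => ?_)
  by_cases hi : i < n
  · exact congrFun (List.ofFn_injective h) ⟨i, hi⟩
  · have : ∀ a : Fin (2 ^ n), (a : ℕ).testBit i = false := fun a =>
      Nat.testBit_eq_false_of_lt (a.2.trans_le (Nat.pow_le_pow_right (by norm_num) (by omega)))
    rw [this, this]

theorem bits_inj {t t' : ℕ} (h : t.bits = t'.bits) : t = t' := by
  refine Nat.eq_of_testBit_eq fun i => ?_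
  rw [Nat.testBit_eq_inth, Nat.testBit_eq_inth, h]

theorem map_length_coeffBits {n : ℕ} (w : Fin n → Fin (2 ^ n)) :
    (coeffBits w).map List.length = List.replicate n n := by
  rw [coeffBits, List.map_ofFn]
  simp [Function.comp_def, List.ofFn_const]

theorem length_flatten_coeffBits {n : ℕ} (w : Fin n → Fin (2 ^ n)) :
    (coeffBits w).flatten.length = n * n := by
  rw [List.length_flatten, map_length_coeffBits]
  simp

/-- The language quantifies over all readings of a string, so the encoding has to be injective. The
unary size and the flagged bits of `s` are self-delimiting, the coefficients fill `n` blocks of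
width `n`, and the threshold is what remains. -/
theorem BinaryDecisionProblem.mem_language_iff (P : BinaryDecisionProblem) {n : ℕ} {s : List Bool}
    {w : Fin n → Fin (2 ^ n)} {t : ℕ} :
    encodeInstance n s w t ∈ P.language ↔ P.Yes n s w t := by
  refine ⟨?_, fun h => ⟨n, s, w, t, rfl, h⟩⟩
  rintro ⟨n', s', w', t', h, hy⟩
  rw [encodeInstance_eq, encodeInstance_eq] at h
  simp only [List.append_assoc, List.cons_append, List.nil_append] at h
  obtain ⟨rfl, hsol⟩ := replicate_true_append_inj h
  obtain ⟨rfl, hrest⟩ := flatMap_append_inj hsol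
  obtain ⟨h1, h2⟩ := List.append_inj hrest (by simp only [length_flatten_coeffBits])
  obtain rfl := bits_inj h2
  have h3 : coeffBits w = coeffBits w' := by
    refine (List.eq_iff_flatten_eq ..).2 ⟨h1, ?_⟩
    rw [map_length_coeffBits, map_length_coeffBits]
  obtain rfl : w = w' := funext fun i => bitsN_inj (congrFun (List.ofFn_injective h3) i)
  exact hy

/-! ### Runs of the whole program -/

/-- The part `r` of the input carries the size and the perturbation parameter. It is only erased:
the algorithm makes no use of the parameter. -/
theorem exec_mainProg_of_encoding {n : ℕ} (s : List Bool) (w : Fin n → Fin (2 ^ n)) (t : ℕ)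
    (r : List (Option Bool)) {F G B : ℕ → Bool} {K : ℕ → ℕ}
    (hF : ∀ b j R, b + j = n → ∀ v : Vars,
      Exec Q (ask false) (v, stageRegs b j R s (coeffBits w) t.bits) (K j)
      ({ v with cur := none, ceil := false, carry := false, res := F j, big := B j },
        stageRegs b j R s (coeffBits w) t.bits))
    (hG : ∀ b j R, b + j = n → 0 < b → ∀ v : Vars,
      Exec Q (ask true) (v, stageRegs b j R s (coeffBits w) t.bits) (K j)
      ({ v with cur := none, ceil := true, carry := false, res := G j, big := B j },
        stageRegs b j R s (coeffBits w) t.bits)) :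
    ∃ v' : Vars, Exec Q mainProg
      ({}, { input := (encodeInstance n s w t).map some ++ none :: r })
      (K 0 + ∑ i ∈ Finset.range (n + 1), ((if knownAnswer F G B i = none then 2 * K i else 0) + 9)
        + 100 * ((encodeInstance n s w t).length + r.length + 1)) (v', {}) ∧
      v'.ans = some ((knownAnswer F G B n).getD (F n)) := by
  have hin : (encodeInstance n s w t).map some ++ none :: r =
      List.replicate n (some true) ++ some false :: ((s.flatMap (fun b => [true, b]) ++ [false]).map
        some ++ ((coeffBits w).flatten.map some ++ (t.bits.map some ++ none :: r))) := by
    rw [encodeInstance_eq]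
    simp
  set m := (coeffBits w).flatten.map some ++ (t.bits.map some ++ none :: r) with hm
  have hlen : ((coeffBits w).flatten.map some).length = n * n := by
    rw [List.length_map, length_flatten_coeffBits]
  have hmap : ((List.range (n * n)).map fun k => m[k]?.getD none) =
      (coeffBits w).flatten.map some := by
    rw [← hlen]
    refine List.ext_getElem (by simp) fun i h1 h2 => ?_
    rw [List.getElem_map, List.getElem_range, hm, List.getElem?_append_left h2,
      List.getElem?_eq_getElem h2, Option.getD_some]
  have hall : ((List.range (n * n)).all fun k => (m[k]?.getD none).isSome) = true := by
    have : ((List.range (n * n)).all fun k => (m[k]?.getD none).isSome) =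
        (((List.range (n * n)).map fun k => m[k]?.getD none).all Option.isSome) := by
      rw [List.all_map]; rfl
    rw [this, hmap]
    simp
  have hdrop : m.drop (n * n) = t.bits.map some ++ none :: r := by
    rw [hm, List.drop_left' hlen]
  have h1 := exec_readSize (Q := Q) n (some false) (by simp)
    ((s.flatMap (fun b => [true, b]) ++ [false]).map some ++ m) {}
  rw [← hin] at h1
  have h2 := exec_readSol (Q := Q) s m
    { input := (s.flatMap (fun b => [true, b]) ++ [false]).map some ++ m,
      size := List.replicate n none, rounds := List.replicate n none,
      low := List.replicate n none } rfl rfl rfl { cur := some (some false) }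
  have h3 := exec_readCoeffs (Q := Q) { cur := none, valid := true }
    { input := m, size := List.replicate n none, rounds := List.replicate n none,
      low := List.replicate n none, sol := s.map some } m n rfl (by simp) (by simp) rfl rfl rfl rfl
  rw [hall, hmap, hdrop] at h3
  have h4 := exec_readThreshold (Q := Q) { cur := none, valid := true }
    { input := t.bits.map some ++ none :: r, size := List.replicate n none,
      rounds := List.replicate n none, low := List.replicate n none, sol := s.map some,
      coeff := (coeffBits w).flatten.map some } t.bits r rfl rfl rfl
  rw [getLast?_bits] at h4
  have h5 := exec_clear (Q := Q) .input { cur := none, valid := true, carry := true }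
    { input := r, size := List.replicate n none,
      rounds := List.replicate n none, low := List.replicate n none, sol := s.map some,
      coeff := (coeffBits w).flatten.map some, thr := t.bits.map some }
  obtain ⟨v', h6, hv'⟩ := exec_solve hF hG { cur := none, valid := true, carry := true } rfl
  have h7 : Exec Q mainProg _ _ _ := exec_seq_clear (h1.seq (.ite_true rfl
    (h2.seq (.ite_true rfl (h3.seq
    (.ite_true rfl (h4.seq (h5.seq (.ite_true rfl h6)))))))))
  refine ⟨_, h7.weaken ?_, hv'⟩
  have ht : (stageRegs 0 n [] s (coeffBits w) t.bits).total allRegs =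
      2 * n + s.length + n * n + t.bits.length := by
    simp only [Regs.total, allRegs, stageRegs, Regs.get, List.map_cons, List.map_nil,
      List.sum_cons, List.sum_nil, List.length_replicate, List.length_map,
      length_flatten_coeffBits, List.length_nil]
    ring
  rw [ht, length_encodeInstance]
  simp only [Regs.get]
  omega

/-- The machine must halt and reject here too, but without a time bound: in the perturbation model
such strings have probability zero. The value `none` will be read as rejection. -/
theorem exec_mainProg_of_not_encoding (y : List Bool) (r : List (Option Bool))
    (hy : ∀ n s w t, y ≠ encodeInstance n s w t) :
    ∃ k v', Exec Q mainProg ({}, { input := y.map some ++ none :: r }) k (v', {}) ∧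
      v'.ans = none := by
  have key : ∀ {p : Prog} {a : Vars × Regs} {k : ℕ} {v : Vars} {ρ : Regs},
      Exec Q p a k (v, ρ) → v.ans = none →
      ∃ k v', Exec Q (.seq p (clearList allRegs)) a k (v', {}) ∧ v'.ans = none :=
    fun h hv => ⟨_, _, exec_seq_clear h, hv⟩
  obtain ⟨n, rfl | ⟨y, rfl⟩⟩ := eq_replicate_true_or y
  · have h1 := exec_readSize (Q := Q) n none (by simp) r {}
    rw [List.map_replicate]
    exact key (h1.seq (.ite_false rfl (.load ..))) rfl
  have h1 := exec_readSize (Q := Q) n (some false) (by simp) (y.map some ++ none :: r) {}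
  have hin : (List.replicate n true ++ false :: y).map some ++ none :: r =
    List.replicate n (some true) ++ some false :: (y.map some ++ none :: r) := by simp
  rw [hin]
  obtain ⟨s, h | h | ⟨y', rfl⟩⟩ := eq_flatMap_or y
  · obtain ⟨k, v', ρ', h2, hv, ha⟩ := exec_readSol_invalid (Q := Q) s (none :: r) r (.inl rfl)
      { input := y.map some ++ none :: r,
        size := List.replicate n none, rounds := List.replicate n none,
        low := List.replicate n none } (by simp [h]) { cur := some (some false) }
    exact key (h1.seq (.ite_true rfl (h2.seq (.ite_false hv (.load ..))))) ha
  · obtain ⟨k, v', ρ', h2, hv, ha⟩ := exec_readSol_invalid (Q := Q) s (some true :: none :: r) r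
      (.inr rfl)
      { input := y.map some ++ none :: r,
        size := List.replicate n none, rounds := List.replicate n none,
        low := List.replicate n none } (by simp [h]) { cur := some (some false) }
    exact key (h1.seq (.ite_true rfl (h2.seq (.ite_false hv (.load ..))))) ha
  set m := y'.map some ++ none :: r with hm
  have h2 := exec_readSol (Q := Q) s m
    { input := ((s.flatMap (fun b => [true, b]) ++ [false]) ++ y').map some ++ none :: r,
      size := List.replicate n none, rounds := List.replicate n none,
      low := List.replicate n none } rfl rfl (by simp [hm]) { cur := some (some false) }
  have h3 := exec_readCoeffs (Q := Q) { cur := none, valid := true }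
    { input := m, size := List.replicate n none, rounds := List.replicate n none,
      low := List.replicate n none, sol := s.map some } m n rfl (by simp) (by simp) rfl rfl rfl rfl
  by_cases hlen : y'.length < n * n
  · have hall : ((List.range (n * n)).all fun k => (m[k]?.getD none).isSome) = false := by
      rw [List.all_eq_false]
      refine ⟨y'.length, List.mem_range.2 hlen, ?_⟩
      simp [hm]
    exact key (h1.seq (.ite_true rfl (h2.seq (.ite_true rfl (h3.seq
      (.ite_false (by simp [hall]) (.load ..))))))) rfl
  · obtain ⟨w, hw⟩ := exists_flatten_bitsN_eq n n (y'.take (n * n)) (by simp; omega)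
    have hdrop : m.drop (n * n) = (y'.drop (n * n)).map some ++ none :: r := by
      rw [hm, List.drop_append_of_le_length (by simp; omega), List.map_drop]
    have hall : ((List.range (n * n)).all fun k => (m[k]?.getD none).isSome) = true := by
      rw [List.all_eq_true]
      intro k hk
      have hk' : k < y'.length := by have := List.mem_range.1 hk; omega
      simp [hm, List.getElem?_append_left, hk']
    rw [hall, hdrop] at h3
    have h4 := exec_readThreshold (Q := Q) { cur := none, valid := true }
      { input := (y'.drop (n * n)).map some ++ none :: r, size := List.replicate n none,
        rounds := List.replicate n none, low := List.replicate n none, sol := s.map some,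
        coeff := (List.range (n * n)).map fun k => m[k]?.getD none } _ r rfl rfl rfl
    by_cases ht : (y'.drop (n * n)).getLast?.getD true = true
    · obtain ⟨t, ht⟩ := exists_bits_eq _ ht
      refine absurd ?_ (hy n s w t)
      rw [encodeInstance_eq, ht, coeffBits, hw]
      simp
    · exact key (h1.seq (.ite_true rfl (h2.seq (.ite_true rfl (h3.seq
        (.ite_true rfl (h4.seq ((exec_clear ..).seq
          (.ite_false (by simpa using ht) (.load ..)))))))))) rfl

/-! ### Rounded instances and the answer to the original instance -/

theorem roundThreshold_le (b j t : ℕ) : roundThreshold b j t ≤ t / 2 ^ b := by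
  unfold roundThreshold
  split_ifs with h
  · refine (Nat.sub_le _ _).trans ((Nat.le_div_iff_mul_le (by positivity)).2 ?_)
    rwa [← pow_add, Nat.add_comm]
  · exact le_rfl

theorem weight_roundCoeffs {n b j : ℕ} {c : Bool} (hn : b + j = n) (hc : c = true → 0 < b)
    (w : Fin n → Fin (2 ^ n)) (x : Fin n → Bool) :
    weight (roundCoeffs c b w) x = ∑ i, (w i / 2 ^ b + c.toNat) * (x i).toNat := by
  simp only [weight, val_roundCoeffs hn hc]

theorem weight_roundCoeffs_false_le {n b j : ℕ} (hn : b + j = n) (w : Fin n → Fin (2 ^ n))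
    (x : Fin n → Bool) : weight (roundCoeffs false b w) x ≤ weight w x / 2 ^ b := by
  rw [weight_roundCoeffs hn (by simp), Nat.le_div_iff_mul_le (by positivity), Finset.sum_mul]
  refine Finset.sum_le_sum fun i _ => ?_
  rw [Bool.toNat_false, Nat.add_zero, mul_right_comm]
  exact Nat.mul_le_mul_right _ (Nat.div_mul_le_self _ _)

theorem weight_le_mul_weight_roundCoeffs {n b j : ℕ} (hn : b + j = n) (hb : 0 < b)
    (w : Fin n → Fin (2 ^ n)) (x : Fin n → Bool) :
    weight w x ≤ 2 ^ b * weight (roundCoeffs true b w) x := by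
  rw [weight_roundCoeffs hn (fun _ => hb), Finset.mul_sum]
  refine Finset.sum_le_sum fun i _ => ?_
  rw [Bool.toNat_true, ← mul_assoc]
  exact Nat.mul_le_mul_right _ (Nat.lt_mul_div_succ _ (by positivity)).le

/-- For `n < 2 ^ j` this stays below the truncated threshold, so truncation cannot be the reason for
an open answer. -/
theorem weight_roundCoeffs_true_le {n b j : ℕ} (hn : b + j = n) (hb : 0 < b)
    (w : Fin n → Fin (2 ^ n)) (x : Fin n → Bool) :
    weight (roundCoeffs true b w) x ≤ n * 2 ^ j := by
  rw [weight_roundCoeffs hn (fun _ => hb)]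
  refine (Finset.sum_le_card_nsmul _ _ (2 ^ j) fun i _ => ?_).trans (by simp)
  have hlt : (w i : ℕ) / 2 ^ b < 2 ^ j :=
    Nat.div_lt_of_lt_mul (by rw [← pow_add, hn]; exact (w i).2)
  calc ((w i : ℕ) / 2 ^ b + true.toNat) * (x i).toNat ≤ 2 ^ j * 1 :=
        Nat.mul_le_mul (by simpa using hlt) (Bool.toNat_le _)
    _ = 2 ^ j := mul_one _

/-- At full precision even a truncated threshold admits every solution, so truncation does not
change the answer. -/
theorem weight_le_pow {n : ℕ} (w : Fin n → Fin (2 ^ n)) (x : Fin n → Bool) :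
    weight w x ≤ 2 ^ (2 * n) - 1 := by
  have h : weight w x ≤ n * (2 ^ n - 1) := by
    refine (Finset.sum_le_card_nsmul _ _ (2 ^ n - 1) fun i _ => ?_).trans (by simp)
    calc (w i : ℕ) * (x i).toNat ≤ (2 ^ n - 1) * 1 :=
          Nat.mul_le_mul (Nat.le_sub_one_of_lt (w i).2) (Bool.toNat_le _)
      _ = 2 ^ n - 1 := mul_one _
  have h1 : n < 2 ^ n := Nat.lt_two_pow_self
  refine h.trans ?_
  have h2 : n * (2 ^ n - 1) ≤ 2 ^ n * (2 ^ n - 1) := Nat.mul_le_mul_right _ h1.le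
  have h3 : 2 ^ (2 * n) = 2 ^ n * 2 ^ n := by rw [two_mul, pow_add]
  rw [Nat.mul_sub (2 ^ n) (2 ^ n) 1, mul_one] at h2
  have h4 : 0 < 2 ^ n := by positivity
  omega

open Classical in
/-- The answer to the rounded instance with precision `j`. -/
def BinaryDecisionProblem.roundedYes (P : BinaryDecisionProblem) {n : ℕ} (s : List Bool)
    (w : Fin n → Fin (2 ^ n)) (t : ℕ) (c : Bool) (j : ℕ) : Bool :=
  decide (P.Yes n s (roundCoeffs c (n - j) w) (roundThreshold (n - j) j t))

/-- The threshold is truncated at precision `j`. -/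
def truncated (n t j : ℕ) : Bool := decide (n - j + 2 * j < t.bits.length)

namespace BinaryDecisionProblem

variable (P : BinaryDecisionProblem) {n : ℕ} (s : List Bool) (w : Fin n → Fin (2 ^ n)) (t : ℕ)

open Classical in
variable {s w t} in
theorem roundedYes_eq_true {c : Bool} {j : ℕ} : P.roundedYes s w t c j = true ↔
    ∃ x ∈ P.solutions n s,
      weight (roundCoeffs c (n - j) w) x ≤ roundThreshold (n - j) j t := by
  unfold roundedYes
  exact decide_eq_true_iff

variable {s w t} in
theorem roundedYes_eq_false {c : Bool} {j : ℕ} : P.roundedYes s w t c j = false ↔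
    ∀ x ∈ P.solutions n s,
      roundThreshold (n - j) j t < weight (roundCoeffs c (n - j) w) x := by
  rw [← Bool.not_eq_true, roundedYes_eq_true]
  simp only [not_exists, not_and, not_le]

theorem roundedYes_zero (h : P.roundedYes s w t false 0 = false) : P.solutions n s = ∅ := by
  rw [roundedYes_eq_false] at h
  refine Set.eq_empty_iff_forall_notMem.2 fun x hx => (h x hx).not_ge ?_
  rw [weight_roundCoeffs (j := 0) (by omega) (by simp)]
  refine le_of_eq_of_le ?_ (Nat.zero_le _)
  refine Finset.sum_eq_zero fun i _ => ?_
  rw [Nat.sub_zero, Nat.div_eq_of_lt (w i).2]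
  simp

/-- A sum of rounded-down terms is at most the rounded-down sum, so any solution of the instance
also solves the rounded one. -/
theorem not_yes_of_roundedYes_eq_false {j : ℕ} (hj : j ≤ n)
    (h : P.roundedYes s w t false j = false) (hB : truncated n t j = false) :
    ¬ P.Yes n s w t := by
  rw [roundedYes_eq_false] at h
  simp only [truncated, decide_eq_false_iff_not, lt_length_bits] at hB
  rintro ⟨x, hx, hxt⟩
  refine (h x hx).not_ge ?_
  rw [roundThreshold, if_neg hB]
  exact (weight_roundCoeffs_false_le (j := j) (by omega) w x).trans (Nat.div_le_div_right hxt)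

/-- The true weight is at most `2 ^ b` times the rounded-up weight, hence at most `2 ^ b * (t / 2 ^
b) ≤ t`. The condition `j < n` ensures that a bit is dropped. -/
theorem yes_of_roundedYes {j : ℕ} (hj : j < n) (h : P.roundedYes s w t true j = true) :
    P.Yes n s w t := by
  obtain ⟨x, hx, hxt⟩ := P.roundedYes_eq_true.1 h
  refine ⟨x, hx, (weight_le_mul_weight_roundCoeffs (j := j) (b := n - j) (by omega) (by omega)
    w x).trans ?_⟩
  exact (Nat.mul_le_mul_left _ (hxt.trans (roundThreshold_le _ _ _))).trans
    (Nat.mul_div_le _ _)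

open Classical in
theorem roundedYes_self : P.roundedYes s w t false n = decide (P.Yes n s w t) := by
  have h1 : roundCoeffs false (n - n) w = w := by
    funext i
    refine Fin.ext ?_
    rw [val_roundCoeffs (j := n) (by omega) (by simp)]
    simp
  simp only [roundedYes, h1, Yes]
  refine decide_eq_decide.2 (exists_congr fun x => and_congr_right fun _ => ?_)
  unfold roundThreshold
  split_ifs with h
  · refine iff_of_true (weight_le_pow w x) ((weight_le_pow w x).trans ?_)
    simp only [Nat.sub_self, Nat.zero_add] at h
    omega
  · simp

/-- The answer that is known before round `j`. -/
def known (j : ℕ) : Option Bool :=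
  knownAnswer (P.roundedYes s w t false) (P.roundedYes s w t true) (truncated n t) j

open Classical in
theorem known_eq_some {j : ℕ} (hj : j ≤ n) {a : Bool} (h : P.known s w t j = some a) :
    a = decide (P.Yes n s w t) := by
  induction j with
  | zero =>
    simp only [known, knownAnswer] at h
    split_ifs at h with h0
    obtain rfl := Option.some.inj h
    have := P.roundedYes_zero s w t (by simpa using h0)
    simp [Yes, this]
  | succ j ih =>
    rw [known, knownAnswer] at h
    rw [known] at ih
    split at h
    · rename_i a' ha
      exact ih (by omega) (ha.trans h)
    · split_ifs at h with h1 h2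
      · obtain rfl := Option.some.inj h
        simp only [Bool.and_eq_true, Bool.not_eq_true'] at h1
        simpa using P.not_yes_of_roundedYes_eq_false s w t (j := j) (by omega) h1.1 h1.2
      · obtain rfl := Option.some.inj h
        simpa using P.yes_of_roundedYes s w t (j := j) (by omega) h2

open Classical in
theorem known_getD : (P.known s w t n).getD (P.roundedYes s w t false n) =
    decide (P.Yes n s w t) := by
  rcases h : P.known s w t n with _ | a
  · exact P.roundedYes_self s w t
  · exact P.known_eq_some s w t le_rfl h

/-! ### Instances whose answer stays open after a round. -/

/-- Some solution that contains `i` is optimal for the coefficients without their `b` lowest bits,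
and its weight is close to the threshold `τ`. -/
def CloseAt (b τ : ℕ) (i : Fin n) (w : Fin n → Fin (2 ^ n)) : Prop :=
  ∃ x ∈ P.solutions n s, x i = true ∧ ∑ k, w k / 2 ^ b * (x k).toNat ≤ τ ∧
    (∀ x' ∈ P.solutions n s, ∑ k, w k / 2 ^ b * (x k).toNat ≤ ∑ k, w k / 2 ^ b * (x' k).toNat) ∧
    τ < ∑ k, w k / 2 ^ b * (x k).toNat + n

/-- An answer is kept once found. Hence an open answer shows that the initial query was answered
positively, so that solutions exist. -/
theorem known_zero_of_known {j : ℕ} (h : P.known s w t j = none) : P.known s w t 0 = none := by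
  induction j with
  | zero => exact h
  | succ j ih =>
    refine ih ?_
    rw [known, knownAnswer] at h
    rw [known]
    split at h
    · simp at h
    · assumption

/-- Once truncation is excluded, an open answer means "yes" with rounding down and "no" with
rounding up. So the rounded-down optimum is at most the threshold, and adding one for each item of
an optimal solution exceeds it. This solution has an item, as otherwise rounding up would not change
its weight. -/
theorem exists_closeAt {j : ℕ} (hj : j < n) (hnj : n < 2 ^ j) (h : P.known s w t (j + 1) = none) :
    ∃ i, P.CloseAt s (n - j) (t / 2 ^ (n - j)) i w := by
  set b := n - j with hb
  have hbj : b + j = n := by omega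
  obtain ⟨x₀, hx₀⟩ : (P.solutions n s).Nonempty := by
    have h0 := P.known_zero_of_known s w t h
    simp only [known, knownAnswer] at h0
    split_ifs at h0 with h1
    obtain ⟨x, hx, -⟩ := P.roundedYes_eq_true.1 h1
    exact ⟨x, hx⟩
  rw [known, knownAnswer] at h
  split at h
  · simp at h
  split_ifs at h with h1 h2
  simp only [Bool.and_eq_true, Bool.not_eq_true', not_and, Bool.not_eq_false] at h1
  rw [Bool.not_eq_true, roundedYes_eq_false, ← hb] at h2
  -- With a truncated threshold every solution would pass the rounded-up test: its weight is at most
  -- `n * 2 ^ j ≤ 2 ^ (2 * j) - 2 ^ j`.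
  have hB : truncated n t j = false := by
    by_contra hB
    have h3 := h2 x₀ hx₀
    simp only [truncated, Bool.not_eq_false, decide_eq_true_eq, lt_length_bits, ← hb] at hB
    rw [roundThreshold, if_pos hB] at h3
    have h4 := weight_roundCoeffs_true_le hbj (by omega) w x₀
    have h5 : n * 2 ^ j + 2 ^ j ≤ 2 ^ (2 * j) := by
      rw [two_mul, pow_add, ← Nat.succ_mul]
      exact Nat.mul_le_mul_right _ hnj
    have : 0 < 2 ^ j := by positivity
    omega
  have hF : P.roundedYes s w t false j = true := by
    by_contra hF
    simp [h1 (by simpa using hF)] at hB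
  simp only [truncated, decide_eq_false_iff_not, lt_length_bits] at hB
  rw [roundedYes_eq_true] at hF
  rw [← hb] at hF hB
  rw [roundThreshold, if_neg hB] at hF h2
  obtain ⟨x₁, hx₁, hle⟩ := hF
  rw [weight_roundCoeffs hbj (by simp)] at hle
  obtain ⟨x, hx, hmin⟩ := Set.exists_min_image (P.solutions n s)
    (fun x => ∑ k, (w k : ℕ) / 2 ^ b * (x k).toNat) (Set.toFinite _) ⟨x₀, hx₀⟩
  have hxτ : ∑ k, (w k : ℕ) / 2 ^ b * (x k).toNat ≤ t / 2 ^ b :=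
    (hmin x₁ hx₁).trans (by simpa using hle)
  have hlt := h2 x hx
  rw [weight_roundCoeffs hbj (fun _ => by omega)] at hlt
  simp only [Bool.toNat_true, Nat.add_mul, one_mul, Finset.sum_add_distrib] at hlt
  have hcard : ∑ k, (x k).toNat ≤ n := by
    refine (Finset.sum_le_card_nsmul _ _ 1 fun i _ => Bool.toNat_le _).trans (by simp)
  obtain ⟨i, hi⟩ : ∃ i, x i = true := by
    by_contra! hne
    have : ∑ k, (x k).toNat = 0 := Finset.sum_eq_zero fun k _ => by simp [hne k]
    omega
  exact ⟨i, x, hx, hi, hxτ, hmin, by omega⟩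

theorem sum_update_div {b : ℕ} {i : Fin n} (w : Fin n → Fin (2 ^ n)) (v : Fin (2 ^ n))
    {x : Fin n → Bool} (hx : x i = true) :
    ∑ k, (Function.update w i v k : ℕ) / 2 ^ b * (x k).toNat =
      v / 2 ^ b + ∑ k ∈ Finset.univ.erase i, (w k : ℕ) / 2 ^ b * (x k).toNat := by
  rw [← Finset.add_sum_erase _ _ (Finset.mem_univ i), Function.update_self, hx]
  congr 1
  · simp
  · refine Finset.sum_congr rfl fun k hk => ?_
    rw [Function.update_of_ne (Finset.ne_of_mem_erase hk)]

-- Let `x` and `x₀` be optimal for two values of the `i`-th coefficient, both containing `i`. The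
-- changed term is common to both in either comparison, so the two optimality conditions force equal
-- weights outside `i`. This common weight `A` does not depend on the value, which leaves a window
-- of length `n` for the rounded coefficient.
open Classical in
theorem card_closeAt_le (b τ : ℕ) (i : Fin n) (w : Fin n → Fin (2 ^ n)) :
    (Finset.univ.filter fun v => P.CloseAt s b τ i (Function.update w i v)).card ≤ n * 2 ^ b := by
  rcases (Finset.univ.filter fun v =>
    P.CloseAt s b τ i (Function.update w i v)).eq_empty_or_nonempty with h | ⟨v₀, hv₀⟩
  · simp [h]
  obtain ⟨x₀, hx₀, hi₀, hle₀, hmin₀, hlt₀⟩ := (Finset.mem_filter.1 hv₀).2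
  rw [sum_update_div w v₀ hi₀] at hle₀ hlt₀
  set A := ∑ k ∈ Finset.univ.erase i, (w k : ℕ) / 2 ^ b * (x₀ k).toNat with hA
  -- The rounded value runs over the integers from `τ + 1 - A - n` to `τ - A`, and each of them has
  -- `2 ^ b` preimages. The bound `A ≤ τ` from `hle₀` justifies the truncated subtraction.
  have hsub : (Finset.univ.filter fun v => P.CloseAt s b τ i (Function.update w i v)).map
      Fin.valEmbedding ⊆ Finset.Ico ((τ + 1 - A - n) * 2 ^ b) ((τ - A + 1) * 2 ^ b) := by
    intro v' hv'
    obtain ⟨v, hv, rfl⟩ := Finset.mem_map.1 hv'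
    obtain ⟨x, hx, hi, hle, hmin, hlt⟩ := (Finset.mem_filter.1 hv).2
    have h1 := hmin x₀ hx₀
    have h2 := hmin₀ x hx
    rw [sum_update_div w v hi] at hle hlt h1
    rw [sum_update_div w _ hi₀] at h1 h2
    rw [sum_update_div w _ hi] at h2
    rw [← hA] at h1 h2
    rw [Finset.mem_Ico, Fin.valEmbedding_apply, ← Nat.le_div_iff_mul_le (by positivity),
      ← Nat.div_lt_iff_lt_mul (by positivity)]
    generalize (v : ℕ) / 2 ^ b = e at *
    generalize (v₀ : ℕ) / 2 ^ b = e₀ at *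
    omega
  have hcard := Finset.card_le_card hsub
  rw [Finset.card_map, Nat.card_Ico, ← Nat.sub_mul] at hcard
  exact hcard.trans (Nat.mul_le_mul_right _ (by omega))

end BinaryDecisionProblem

/-! ### Products of bounded distributions -/

-- Fix all coordinates except `i`. At most `m` values of the remaining one lie in the event, each of
-- probability at most `ψ`; averaging over the fixed coordinates keeps the bound.
open Classical in
theorem independentLaw_sum_le {n : ℕ} {α : Type} [Fintype α] (p : Fin n → PMF α) (i : Fin n)
    {ψ : ℝ≥0∞} (hp : ∀ a, p i a ≤ ψ) (E : (Fin n → α) → Prop) (m : ℕ)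
    (hE : ∀ w, (Finset.univ.filter fun v => E (Function.update w i v)).card ≤ m) :
    ∑ w, (if E w then independentLaw p w else 0) ≤ m * ψ := by
  obtain _ | n := n
  · exact i.elim0
  have hlaw : ∀ w, independentLaw p w = ∏ i, p i (w i) := fun w => rfl
  have hsum : ∀ q : Fin n → PMF α, ∑ v : Fin n → α, ∏ k, q k (v k) = 1 := fun q => by
    rw [← Fintype.prod_sum (fun i a => q i a)]
    exact Finset.prod_eq_one fun i _ => (tsum_fintype _).symm.trans (q i).tsum_coe
  rw [← (Fin.insertNthEquiv (fun _ => α) i).sum_comp, Fintype.sum_prod_type_right]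
  calc _ ≤ ∑ v : Fin n → α, (∏ k, p (i.succAbove k) (v k)) * (m * ψ) := by
        refine Finset.sum_le_sum fun v _ => ?_
        rcases isEmpty_or_nonempty α with hα | ⟨⟨a₀⟩⟩
        · simp
        have h1 : ∀ a, (if E (i.insertNth a v) then independentLaw p (i.insertNth a v) else 0) ≤
            (∏ k, p (i.succAbove k) (v k)) * (if E (i.insertNth a v) then ψ else 0) := by
          intro a
          split_ifs
          · rw [hlaw, Fin.prod_univ_succAbove _ i, mul_comm]
            simp only [Fin.insertNth_apply_same, Fin.insertNth_apply_succAbove]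
            gcongr
            exact hp a
          · simp
        refine (Finset.sum_le_sum fun a _ => h1 a).trans ?_
        rw [← Finset.mul_sum]
        gcongr
        rw [← Finset.sum_filter, Finset.sum_const, nsmul_eq_mul]
        gcongr
        -- The value `a₀` is arbitrary, since `hE` overwrites coordinate `i`.
        have h2 := hE (i.insertNth a₀ v)
        simpa only [Fin.update_insertNth] using h2
    _ = m * ψ := by
        rw [← Finset.sum_mul, hsum fun k => p (i.succAbove k), one_mul]

/-! ### The algorithm and its running time -/

/-- The cost of one query in round `j` on an instance of length `l`. -/
def roundCost (p : Polynomial ℕ) (l j : ℕ) : ℕ :=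
  150 * l + (∑ i ∈ Finset.range (p.natDegree + 1), p.coeff i) * (3 * l + 4 ^ j) ^ p.natDegree

theorem bits_length_roundThreshold_le (b j t : ℕ) : (roundThreshold b j t).bits.length ≤ 2 * j := by
  rw [Nat.size_eq_bits_len, Nat.size_le]
  exact roundThreshold_lt b j t

theorem maxNumber_round_le {n b j : ℕ} {c : Bool} (hn : b + j = n) (hc : c = true → 0 < b)
    (w : Fin n → Fin (2 ^ n)) (t : ℕ) :
    maxNumber (roundCoeffs c b w) (roundThreshold b j t) ≤ 4 ^ j := by
  have h4 : 4 ^ j = 2 ^ j * 2 ^ j := by rw [← mul_pow]; norm_num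
  refine max_le (Finset.sup_le fun i _ => ?_) ?_
  · rw [val_roundCoeffs hn hc, h4]
    have hlt : (w i : ℕ) / 2 ^ b < 2 ^ j :=
      Nat.div_lt_of_lt_mul (by rw [← pow_add, hn]; exact (w i).2)
    have h1 : c.toNat ≤ 1 := Bool.toNat_le c
    have h2 : 2 ^ j * 1 ≤ 2 ^ j * 2 ^ j := Nat.mul_le_mul_left _ Nat.one_le_two_pow
    omega
  · rw [h4, ← pow_add, ← two_mul]
    exact (roundThreshold_lt b j t).le

/-- Replacing a polynomial by a single power lets all time bounds be combined into a power of `n * 2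
^ i`. -/
theorem eval_le_sum_coeff_mul (p : Polynomial ℕ) {m k : ℕ} (hk : 1 ≤ k) (hm : m ≤ k) :
    p.eval m ≤ (∑ i ∈ Finset.range (p.natDegree + 1), p.coeff i) * k ^ p.natDegree := by
  rw [Polynomial.eval_eq_sum_range, Finset.sum_mul]
  refine Finset.sum_le_sum fun i hi => Nat.mul_le_mul_left _ ?_
  exact (Nat.pow_le_pow_left hm i).trans
    (Nat.pow_le_pow_right hk (Nat.le_of_lt_succ (Finset.mem_range.1 hi)))

/-- The machine `M` solves `P` in pseudo-polynomial time, with the bound `p`. -/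
def BinaryDecisionProblem.SolvedBy (P : BinaryDecisionProblem)
    (M : Turing.TM2ComputableAux Bool Bool) (p : Polynomial ℕ) : Prop :=
  ∀ n s w t, AnswersWithin M (encodeInstance n s w t) (P.Yes n s w t)
    (p.eval ((encodeInstance n s w t).length + maxNumber w t))

variable {P : BinaryDecisionProblem} {M : Turing.TM2ComputableAux Bool Bool} {p : Polynomial ℕ}

theorem exec_ask_rounded (hM : P.SolvedBy M p) {n b j : ℕ} {c : Bool} (hn : b + j = n)
    (hc : c = true → 0 < b)
    (s : List Bool) (w : Fin n → Fin (2 ^ n)) (t : ℕ) (R : List (Option Bool)) (v : Vars) :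
    Exec (Answers M) (ask c) (v, stageRegs b j R s (coeffBits w) t.bits)
      (roundCost p (encodeInstance n s w t).length j)
      ({ v with cur := none, ceil := c, carry := false, res := P.roundedYes s w t c j,
                big := truncated n t j }, stageRegs b j R s (coeffBits w) t.bits) := by
  obtain rfl : b = n - j := by omega
  have hQ : Answers M (stageQuery c (n - j) j s (coeffBits w) t.bits) (P.roundedYes s w t c j)
      (p.eval ((encodeInstance n s (roundCoeffs c (n - j) w)
        (roundThreshold (n - j) j t)).length +
          maxNumber (roundCoeffs c (n - j) w) (roundThreshold (n - j) j t))) := by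
    rw [stageQuery_eq hn hc]
    exact hM n s (roundCoeffs c (n - j) w) (roundThreshold (n - j) j t)
  have h := exec_ask (Q := Answers M) c (n - j) j R s (coeffBits w) t.bits (by simp [coeffBits, hn])
    (fun l hl => by
      obtain ⟨i, rfl⟩ := (List.mem_ofFn' _ _).1 hl
      rw [length_bitsN, hn]) v hQ
  refine h.weaken ?_
  rw [stageQuery_eq hn hc, hn, roundCost]
  have hm := maxNumber_round_le hn hc w t
  have ht := bits_length_roundThreshold_le (n - j) j t
  have hl := length_encodeInstance n s w t
  have hl' := length_encodeInstance n s (roundCoeffs c (n - j) w) (roundThreshold (n - j) j t)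
  -- Only the threshold can become longer, and it has at most `2 * j ≤ 2 * n` bits; hence the factor
  -- `3`.
  have hle : (encodeInstance n s (roundCoeffs c (n - j) w) (roundThreshold (n - j) j t)).length ≤
      3 * (encodeInstance n s w t).length := by omega
  have he := eval_le_sum_coeff_mul p (k := 3 * (encodeInstance n s w t).length + 4 ^ j)
    (by omega) (add_le_add hle hm)
  have hn2 : n ≤ n * n := Nat.le_mul_self n
  omega


/-! ### The complete algorithm and its total running time. -/

/-- The part of the input that follows the string `y`. -/
def paramInput (n : ℕ) (φ : ℚ≥0) : List (Option Bool) :=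
  n.bits.map some ++ none :: (φ.num.bits.map some ++ none :: φ.den.bits.map some)

/-- The algorithm that solves instances with increasing precision. -/
def smoothedMachine (M : Turing.TM2ComputableAux Bool Bool) :
    Turing.TM2ComputableAux (Option Bool) Bool :=
  machine M mainProg fun v => v.ans.getD false

theorem smoothedMachine_answers_encoding (hM : P.SolvedBy M p) {n : ℕ} (s : List Bool)
    (w : Fin n → Fin (2 ^ n)) (t m : ℕ) (φ : ℚ≥0) :
    AnswersWithin (smoothedMachine M) (algInput (encodeInstance n s w t) m φ)
      (encodeInstance n s w t ∈ P.language)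
      (roundCost p (encodeInstance n s w t).length 0 + ∑ i ∈ Finset.range (n + 1),
        ((if P.known s w t i = none then 2 * roundCost p (encodeInstance n s w t).length i else 0)
          + 9) + 100 * ((encodeInstance n s w t).length + (paramInput m φ).length + 1) + 1) := by
  obtain ⟨v, hv, ha⟩ := exec_mainProg_of_encoding (Q := Answers M) s w t (paramInput m φ)
    (F := P.roundedYes s w t false) (G := P.roundedYes s w t true) (B := truncated n t)
    (K := roundCost p (encodeInstance n s w t).length)
    (fun b j R hn v => exec_ask_rounded hM hn (by simp) s w t R v)
    (fun b j R hn hb v => exec_ask_rounded hM hn (fun _ => hb) s w t R v)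
  have h := machine_outputs (fun v => v.ans.getD false) hv
  have hout : v.ans.getD false = open Classical in
      decide (encodeInstance n s w t ∈ P.language) := by
    rw [ha, Option.getD_some]
    refine (P.known_getD s w t).trans ?_
    classical exact decide_eq_decide.2 P.mem_language_iff.symm
  rw [hout] at h
  exact h

theorem exists_smoothedMachine_answers (hM : P.SolvedBy M p) (y : List Bool) (m : ℕ) (φ : ℚ≥0) :
    ∃ T, AnswersWithin (smoothedMachine M) (algInput y m φ) (y ∈ P.language) T := by
  by_cases hy : ∃ n s w t, y = encodeInstance n s w t
  · obtain ⟨n, s, w, t, rfl⟩ := hy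
    exact ⟨_, smoothedMachine_answers_encoding hM s w t m φ⟩
  · obtain ⟨k, v, hv, ha⟩ := exec_mainProg_of_not_encoding (Q := Answers M) y (paramInput m φ)
      fun n s w t h => hy ⟨n, s, w, t, h⟩
    have h := machine_outputs (fun v => v.ans.getD false) hv
    have hout : v.ans.getD false = open Classical in decide (y ∈ P.language) := by
      have : y ∉ P.language := fun ⟨n, s, w, t, h, _⟩ => hy ⟨n, s, w, t, h⟩
      classical rw [ha, decide_eq_false this]
      rfl
    rw [hout] at h
    exact ⟨_, h⟩

/-- The running time of the algorithm. -/
def runTime (P : BinaryDecisionProblem) (M : Turing.TM2ComputableAux Bool Bool) (y : List Bool)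
    (m : ℕ) (φ : ℚ≥0) : ℕ :=
  sInf {T | AnswersWithin (smoothedMachine M) (algInput y m φ) (y ∈ P.language) T}

/-- Because `runTime` is the least valid bound, the mere existence of a bound suffices for strings
that encode nothing, and every explicit bound for an encoding is an upper bound of it. -/
theorem smoothedMachine_answers (hM : P.SolvedBy M p) (y : List Bool) (m : ℕ) (φ : ℚ≥0) :
    AnswersWithin (smoothedMachine M) (algInput y m φ) (y ∈ P.language) (runTime P M y m φ) :=
  Nat.sInf_mem (exists_smoothedMachine_answers hM y m φ)

theorem length_paramInput_le (n : ℕ) (φ : ℚ≥0) :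
    (paramInput n φ).length ≤ n + (φ.num.size + φ.den.size) + 2 := by
  have h : n.size ≤ n := Nat.size_le.2 Nat.lt_two_pow_self
  simp only [paramInput, List.length_append, List.length_map, List.length_cons,
    Nat.size_eq_bits_len]
  omega

/-- For instances and parameters of polynomial length, the time of round `i` is polynomial
in `n * 2 ^ i`. -/
theorem exists_runTime_le (hM : P.SolvedBy M p) (q q' : Polynomial ℕ) :
    ∃ C d : ℕ, 0 < d ∧ ∀ (n : ℕ) (s : List Bool) (w : Fin n → Fin (2 ^ n)) (t : ℕ) (φ : ℚ≥0),
      0 < n → (encodeInstance n s w t).length ≤ q.eval n →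
      φ.num.size + φ.den.size ≤ q'.eval n →
      runTime P M (encodeInstance n s w t) n φ ≤ C * n ^ d +
        ∑ i ∈ Finset.range (n + 1), if P.known s w t i = none then C * (n * 2 ^ i) ^ d else 0 := by
  set a := ∑ i ∈ Finset.range (q.natDegree + 1), q.coeff i
  set a' := ∑ i ∈ Finset.range (q'.natDegree + 1), q'.coeff i
  set c := ∑ i ∈ Finset.range (p.natDegree + 1), p.coeff i
  -- The exponent dominates both degrees, and the summand `2` covers `4 ^ i = (2 ^ i) ^ 2`. The
  -- factor `p.natDegree + 1` in `D` then covers both the linear part of `roundCost` and the power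
  -- from `p`.
  set e := q.natDegree + q'.natDegree + 2 with he
  set D := e * (p.natDegree + 1) with hD
  have hDpos : 0 < D := by positivity
  have hcost : ∀ n l i : ℕ, 0 < n → l ≤ a * n ^ e → roundCost p l i ≤
      (150 * a + c * (3 * a + 1) ^ p.natDegree) * (n * 2 ^ i) ^ D := by
    intro n l i hn hl
    have hN : 1 ≤ n * 2 ^ i := Nat.mul_pos hn (by positivity)
    have h1 : l ≤ a * (n * 2 ^ i) ^ e := hl.trans (Nat.mul_le_mul_left _
      (Nat.pow_le_pow_left (Nat.le_mul_of_pos_right _ (by positivity)) _))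
    have h2 : 4 ^ i ≤ (n * 2 ^ i) ^ e := by
      calc 4 ^ i = (2 ^ i) ^ 2 := by rw [← pow_mul, mul_comm, pow_mul]; norm_num
        _ ≤ (n * 2 ^ i) ^ 2 := Nat.pow_le_pow_left (Nat.le_mul_of_pos_left _ hn) _
        _ ≤ _ := Nat.pow_le_pow_right hN (by omega)
    have h3 : (n * 2 ^ i) ^ e ≤ (n * 2 ^ i) ^ D :=
      Nat.pow_le_pow_right hN (Nat.le_mul_of_pos_right _ (by positivity))
    have h4 : ((n * 2 ^ i) ^ e) ^ p.natDegree ≤ (n * 2 ^ i) ^ D := by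
      rw [← pow_mul]
      exact Nat.pow_le_pow_right hN (Nat.mul_le_mul_left _ (by omega))
    calc roundCost p l i
        ≤ 150 * (a * (n * 2 ^ i) ^ D) + c * ((3 * a + 1) * (n * 2 ^ i) ^ e) ^ p.natDegree := by
          unfold roundCost
          have h5 : 3 * l + 4 ^ i ≤ (3 * a + 1) * (n * 2 ^ i) ^ e := by nlinarith
          gcongr
          exact h1.trans (Nat.mul_le_mul_left _ h3)
      _ ≤ 150 * (a * (n * 2 ^ i) ^ D) + c * ((3 * a + 1) ^ p.natDegree * (n * 2 ^ i) ^ D) := by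
          rw [mul_pow (3 * a + 1)]
          exact Nat.add_le_add_left (Nat.mul_le_mul_left _ (Nat.mul_le_mul_left _ h4)) _
      _ = _ := by ring
  set k := 150 * a + c * (3 * a + 1) ^ p.natDegree
  -- `2 * k` pays for the two queries of a round, the rest for reading, erasing and the constant
  -- cost of each round.
  refine ⟨2 * k + (100 * (a + a' + 5) + 19), D, hDpos, fun n s w t φ hn hq hq' => ?_⟩
  refine (Nat.sInf_le (smoothedMachine_answers_encoding hM s w t n φ)).trans ?_
  set l := (encodeInstance n s w t).length
  have hpow : ∀ i, i ≤ e → n ^ i ≤ n ^ e := fun i hi => Nat.pow_le_pow_right hn hi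
  have hl : l ≤ a * n ^ e := hq.trans ((eval_le_sum_coeff_mul q hn le_rfl).trans
    (Nat.mul_le_mul_left _ (hpow _ (by omega))))
  have hφ : φ.num.size + φ.den.size ≤ a' * n ^ e :=
    hq'.trans ((eval_le_sum_coeff_mul q' hn le_rfl).trans
      (Nat.mul_le_mul_left _ (hpow _ (by omega))))
  have hr := length_paramInput_le n φ
  have hn1 : n ≤ n ^ e := by simpa using hpow 1 (by omega)
  have hnD : n ^ e ≤ n ^ D := Nat.pow_le_pow_right hn (Nat.le_mul_of_pos_right _ (by positivity))
  have h0 := hcost n l 0 hn hl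
  rw [pow_zero, mul_one] at h0
  have hsum : ∑ i ∈ Finset.range (n + 1), ((if P.known s w t i = none then 2 * roundCost p l i
      else 0) + 9) ≤ 9 * (n + 1) + ∑ i ∈ Finset.range (n + 1),
        if P.known s w t i = none then (2 * k + (100 * (a + a' + 5) + 19)) * (n * 2 ^ i) ^ D
          else 0 := by
    rw [Finset.sum_add_distrib, add_comm]
    refine add_le_add (by simp [mul_comm]) (Finset.sum_le_sum fun i _ => ?_)
    split_ifs
    · have := hcost n l i hn hl
      nlinarith [Nat.zero_le ((100 * (a + a' + 5) + 19) * (n * 2 ^ i) ^ D)]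
    · exact le_rfl
  have hl2 : l ≤ a * n ^ D := hl.trans (Nat.mul_le_mul_left _ hnD)
  have hφ2 : φ.num.size + φ.den.size ≤ a' * n ^ D := hφ.trans (Nat.mul_le_mul_left _ hnD)
  have h6 : (2 * k + (100 * (a + a' + 5) + 19)) * n ^ D = 2 * (k * n ^ D) +
      100 * (a * n ^ D) + 100 * (a' * n ^ D) + 519 * n ^ D := by ring
  rw [h6]
  have h7 : 0 ≤ k * n ^ D := Nat.zero_le _
  omega

/-! ### The probability of an unknown answer -/

theorem independentLaw_sum {n : ℕ} {α : Type} [Fintype α] (p : Fin n → PMF α) :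
    ∑ w, independentLaw p w = 1 :=
  (tsum_fintype _).symm.trans (independentLaw p).tsum_coe

/-- For `i = j + 1` with `n < 2 ^ j`, a union bound over the `n` coordinates gives probability at
most `n * (n * 2 ^ (n - j) * ψ)`; the factor `2` comes from `2 ^ (j + 1)`. In the early rounds `2 ^
i ≤ 2 * n`, and probability at most `1` together with `hψ` is enough. -/
theorem known_eq_none_sum_mul_le (P : BinaryDecisionProblem) {n : ℕ} (hn : 0 < n) (s : List Bool)
    (t : ℕ) (p : Fin n → PMF (Fin (2 ^ n))) {ψ : ℝ≥0∞} (hp : ∀ i a, p i a ≤ ψ)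
    (hψ : 1 ≤ 2 ^ n * ψ) {i : ℕ} (hi : i ≤ n) :
    (∑ w, if P.known s w t i = none then independentLaw p w else 0) * 2 ^ i ≤
      2 * n ^ 2 * (2 ^ n * ψ) := by
  classical
  have hle : (∑ w, if P.known s w t i = none then independentLaw p w else 0) ≤ 1 := by
    rw [← independentLaw_sum p]
    refine Finset.sum_le_sum fun w _ => ?_
    split_ifs <;> simp
  have hn1 : (1 : ℝ≥0∞) ≤ n := by exact_mod_cast hn
  have hn2 : (n : ℝ≥0∞) ≤ n ^ 2 := by rw [sq]; exact le_mul_of_one_le_left' hn1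
  have htriv : (2 : ℝ≥0∞) ^ i ≤ 2 * n → (∑ w, if P.known s w t i = none then independentLaw p w
      else 0) * 2 ^ i ≤ 2 * n ^ 2 * (2 ^ n * ψ) := fun h =>
    calc _ ≤ 1 * (2 * (n : ℝ≥0∞)) := mul_le_mul' hle h
      _ ≤ 2 * n ^ 2 * 1 := by rw [one_mul, mul_one]; gcongr
      _ ≤ _ := by gcongr
  obtain _ | j := i
  · exact htriv (by
      rw [pow_zero]
      exact le_mul_of_one_le_of_le one_le_two hn1)
  by_cases hnj : n < 2 ^ j
  · have h1 : (∑ w, if P.known s w t (j + 1) = none then independentLaw p w else 0) ≤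
        ∑ k : Fin n, ∑ w, if P.CloseAt s (n - j) (t / 2 ^ (n - j)) k w then independentLaw p w
          else 0 := by
      rw [Finset.sum_comm]
      refine Finset.sum_le_sum fun w _ => ?_
      split_ifs with h
      · obtain ⟨k, hk⟩ := P.exists_closeAt s w t (by omega) hnj h
        refine le_trans ?_ (Finset.single_le_sum (fun _ _ => zero_le) (Finset.mem_univ k))
        rw [if_pos hk]
      · exact zero_le
    have h2 : ∀ k : Fin n, (∑ w, if P.CloseAt s (n - j) (t / 2 ^ (n - j)) k w then
        independentLaw p w else 0) ≤ (n * 2 ^ (n - j) : ℕ) * ψ := fun k =>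
      independentLaw_sum_le p k (hp k) _ _ fun w => P.card_closeAt_le s _ _ k w
    calc _ ≤ (n * ((n * 2 ^ (n - j) : ℕ) * ψ)) * 2 ^ (j + 1) := by
          gcongr
          refine h1.trans ((Finset.sum_le_card_nsmul _ _ _ fun k _ => h2 k).trans ?_)
          simp
      _ = 2 * n ^ 2 * (2 ^ (n - j) * 2 ^ j * ψ) := by push_cast; ring
      _ = _ := by rw [← pow_add, Nat.sub_add_cancel (by omega)]
  · refine htriv ?_
    rw [pow_succ, mul_comm]
    gcongr
    exact_mod_cast not_lt.1 hnj

/-! ### Moments of the running time -/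

/-- The ratio of the geometric series that bounds the expected running time. -/
def ratio : ℝ≥0∞ := 2⁻¹ ^ (1 / 8 : ℝ)

theorem ratio_lt_one : ratio < 1 :=
  ENNReal.rpow_lt_one (by simp) (by norm_num)

/-- As `a ≤ 1`, it is at most its fourth root `(a ^ 2) ^ (1 / 8)`. Under the eighth root `a ^ 2 * n
* 2 ^ i = (a * 2 ^ i) ^ 2 * n * 2⁻¹ ^ i ≤ 4 * n ^ 5 * X ^ 2 * 2⁻¹ ^ i`: squaring `a` turns the
growth into decay. The exponent `8` is large enough for the result to be linear in `n * X`. -/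
theorem mul_rpow_le {a n X : ℝ≥0∞} {i : ℕ} (ha : a ≤ 1) (hn : 1 ≤ n) (hX : 1 ≤ X)
    (h : a * 2 ^ i ≤ 2 * n ^ 2 * X) :
    a * (n * 2 ^ i) ^ (1 / 8 : ℝ) ≤ 4 * (n * X) * ratio ^ i := by
  have h1 : a ≤ (a ^ 2) ^ (1 / 8 : ℝ) := by
    rw [← ENNReal.rpow_natCast, ← ENNReal.rpow_mul]
    calc a = a ^ (1 : ℝ) := (ENNReal.rpow_one a).symm
      _ ≤ _ := ENNReal.rpow_le_rpow_of_exponent_ge ha (by norm_num)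
  have h2 : a ^ 2 * (n * 2 ^ i) ≤ (4 * (n * X)) ^ 8 * 2⁻¹ ^ i := by
    have h3 : (2 : ℝ≥0∞) ^ i * 2⁻¹ ^ i = 1 := by
      rw [← mul_pow, ENNReal.mul_inv_cancel (by simp) (by simp), one_pow]
    calc a ^ 2 * (n * 2 ^ i) = a ^ 2 * (n * 2 ^ i) * (2 ^ i * 2⁻¹ ^ i) := by rw [h3, mul_one]
      _ = (a * 2 ^ i) ^ 2 * n * 2⁻¹ ^ i := by ring
      _ ≤ (2 * n ^ 2 * X) ^ 2 * n * 2⁻¹ ^ i := by gcongr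
      _ = (4 * n ^ 5 * X ^ 2) * 2⁻¹ ^ i := by ring
      _ ≤ (4 ^ 8 * n ^ 8 * X ^ 8) * 2⁻¹ ^ i := by
          gcongr ?_ * ?_ * ?_ * _
          · norm_num
          · exact pow_le_pow_right₀ hn (by norm_num)
          · exact pow_le_pow_right₀ hX (by norm_num)
      _ = _ := by rw [mul_pow, mul_pow, mul_assoc (4 ^ 8)]
  calc a * (n * 2 ^ i) ^ (1 / 8 : ℝ) ≤ (a ^ 2) ^ (1 / 8 : ℝ) * (n * 2 ^ i) ^ (1 / 8 : ℝ) := by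
        gcongr
    _ = (a ^ 2 * (n * 2 ^ i)) ^ (1 / 8 : ℝ) :=
        (ENNReal.mul_rpow_of_nonneg _ _ (by norm_num)).symm
    _ ≤ ((4 * (n * X)) ^ 8 * 2⁻¹ ^ i) ^ (1 / 8 : ℝ) := by gcongr
    _ = 4 * (n * X) * ratio ^ i := by
        rw [ENNReal.mul_rpow_of_nonneg _ _ (by norm_num), ratio]
        simp only [← ENNReal.rpow_natCast, ← ENNReal.rpow_mul]
        norm_num [mul_comm]

/-- Since `ε ≤ 1`, the `ε`-th power is subadditive, so the rounds can be treated separately. With `ε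
= 1 / (8 * d)` the degree `d` cancels, and `mul_rpow_le` makes the contributions geometric. -/
theorem sum_rpow_le {Ω : Type} [Fintype Ω] (μ : Ω → ℝ≥0∞) (hμ : ∑ ω, μ ω = 1)
    (U : ℕ → Ω → Prop) [∀ i, DecidablePred (U i)] (T : Ω → ℕ) {C d n : ℕ} (hd : 0 < d) (hn : 0 < n)
    {X : ℝ≥0∞} (hX : 1 ≤ X)
    (hT : ∀ ω, μ ω ≠ 0 → T ω ≤ C * n ^ d +
      ∑ i ∈ Finset.range (n + 1), if U i ω then C * (n * 2 ^ i) ^ d else 0)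
    (hU : ∀ i ≤ n, (∑ ω, if U i ω then μ ω else 0) * 2 ^ i ≤ 2 * n ^ 2 * X) :
    ∑ ω, μ ω * (T ω : ℝ≥0∞) ^ (1 / (8 * d) : ℝ) ≤
      (C : ℝ≥0∞) ^ (1 / (8 * d) : ℝ) * (1 + 4 * (1 - ratio)⁻¹) * (n * X) := by
  set ε : ℝ := 1 / (8 * d) with hε
  have hd' : (0 : ℝ) < d := by exact_mod_cast hd
  have hε0 : 0 < ε := by positivity
  have hε1 : ε ≤ 1 := by
    rw [hε, div_le_one (by positivity)]
    have : (1 : ℝ) ≤ d := by exact_mod_cast hd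
    linarith
  have hpow : ∀ m : ℕ, ((C * m ^ d : ℕ) : ℝ≥0∞) ^ ε = (C : ℝ≥0∞) ^ ε * (m : ℝ≥0∞) ^ (1 / 8 : ℝ) := by
    intro m
    push_cast
    rw [ENNReal.mul_rpow_of_nonneg _ _ hε0.le, ← ENNReal.rpow_natCast, ← ENNReal.rpow_mul]
    congr 2
    rw [hε]
    field_simp
  have hn1 : (1 : ℝ≥0∞) ≤ n := by exact_mod_cast hn
  have hterm : ∀ ω, μ ω * (T ω : ℝ≥0∞) ^ ε ≤ μ ω * ((C : ℝ≥0∞) ^ ε * (n : ℝ≥0∞) ^ (1 / 8 : ℝ)) +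
      ∑ i ∈ Finset.range (n + 1), (if U i ω then μ ω else 0) *
        ((C : ℝ≥0∞) ^ ε * (n * 2 ^ i) ^ (1 / 8 : ℝ)) := by
    intro ω
    by_cases h0 : μ ω = 0
    · simp [h0]
    have hsub : (T ω : ℝ≥0∞) ^ ε ≤ ((C * n ^ d : ℕ) : ℝ≥0∞) ^ ε + ∑ i ∈ Finset.range (n + 1),
        ((if U i ω then C * (n * 2 ^ i) ^ d else 0 : ℕ) : ℝ≥0∞) ^ ε := by
      have h1 : (T ω : ℝ≥0∞) ≤ ((C * n ^ d : ℕ) : ℝ≥0∞) + ∑ i ∈ Finset.range (n + 1),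
          ((if U i ω then C * (n * 2 ^ i) ^ d else 0 : ℕ) : ℝ≥0∞) := by exact_mod_cast hT ω h0
      refine (ENNReal.rpow_le_rpow h1 hε0.le).trans
        ((ENNReal.rpow_add_le_add_rpow _ _ hε0.le hε1).trans (add_le_add le_rfl ?_))
      exact Finset.le_sum_of_subadditive (fun a : ℝ≥0∞ => a ^ ε) (ENNReal.zero_rpow_of_pos hε0).le
        (fun a b => ENNReal.rpow_add_le_add_rpow a b hε0.le hε1) _ _
    refine (mul_le_mul' le_rfl hsub).trans ?_
    rw [mul_add, hpow, Finset.mul_sum]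
    refine add_le_add le_rfl (Finset.sum_le_sum fun i _ => ?_)
    split_ifs
    · rw [hpow]
      push_cast
      exact le_rfl
    · simp [ENNReal.zero_rpow_of_pos hε0]
  calc _ ≤ _ := Finset.sum_le_sum fun ω _ => hterm ω
    _ = (C : ℝ≥0∞) ^ ε * ((n : ℝ≥0∞) ^ (1 / 8 : ℝ) + ∑ i ∈ Finset.range (n + 1),
        (∑ ω, if U i ω then μ ω else 0) * (n * 2 ^ i) ^ (1 / 8 : ℝ)) := by
        rw [Finset.sum_add_distrib, ← Finset.sum_mul, hμ, one_mul, Finset.sum_comm, mul_add,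
          Finset.mul_sum]
        congr 1
        refine Finset.sum_congr rfl fun i _ => ?_
        rw [← Finset.sum_mul]
        ring
    _ ≤ (C : ℝ≥0∞) ^ ε * (n * X + ∑ i ∈ Finset.range (n + 1), 4 * (n * X) * ratio ^ i) := by
        refine mul_le_mul' le_rfl (add_le_add ?_ (Finset.sum_le_sum fun i hi => ?_))
        · calc (n : ℝ≥0∞) ^ (1 / 8 : ℝ) ≤ (n : ℝ≥0∞) ^ (1 : ℝ) :=
                ENNReal.rpow_le_rpow_of_exponent_le hn1 (by norm_num)
            _ = n := ENNReal.rpow_one _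
            _ ≤ n * X := le_mul_of_one_le_right' hX
        · refine mul_rpow_le ?_ hn1 hX (hU i (Nat.le_of_lt_succ (Finset.mem_range.1 hi)))
          rw [← hμ]
          refine Finset.sum_le_sum fun w _ => ?_
          split_ifs <;> simp
    _ ≤ (C : ℝ≥0∞) ^ ε * (n * X + 4 * (n * X) * (1 - ratio)⁻¹) := by
        rw [← Finset.mul_sum, ← ENNReal.tsum_geometric]
        gcongr
        exact ENNReal.sum_le_tsum _
    _ = _ := by ring

theorem tsum_map_mul {α β : Type} [Fintype α] (μ : PMF α) (f : α → β) (g : β → ℝ≥0∞) :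
    ∑' y, μ.map f y * g y = ∑ a, μ a * g (f a) := by
  classical
  simp only [PMF.map_apply, tsum_fintype, Finset.sum_mul]
  rw [Summable.tsum_finsetSum fun _ _ => ENNReal.summable]
  refine Finset.sum_congr rfl fun a _ => ?_
  rw [tsum_eq_single (f a) fun y hy => by simp [hy]]
  simp

theorem hasSmoothedPolyTime_runTime {P : BinaryDecisionProblem}
    {M : Turing.TM2ComputableAux Bool Bool} {p : Polynomial ℕ} (hM : P.SolvedBy M p)
    {D : ParamFamily} (hD : IsPerturbationModel D) : HasSmoothedPolyTime (runTime P M) D := by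
  obtain ⟨q, hq⟩ := D.support_poly
  obtain ⟨q', hq'⟩ := D.param_poly
  obtain ⟨C, d, hd, hT⟩ := exists_runTime_le hM q q'
  have hd' : (0 : ℝ) < d := by exact_mod_cast hd
  have hfin : (C : ℝ≥0∞) ^ (1 / (8 * d) : ℝ) * (1 + 4 * (1 - ratio)⁻¹) ≠ ⊤ := by
    refine ENNReal.mul_ne_top (ENNReal.rpow_ne_top_of_nonneg (by positivity) (by simp))
      (ENNReal.add_ne_top.2 ⟨by simp, ENNReal.mul_ne_top (by simp) (ENNReal.inv_ne_top.2 ?_)⟩)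
    exact (tsub_pos_of_lt ratio_lt_one).ne'
  refine ⟨1 / (8 * d), by positivity,
    ((C : ℝ≥0∞) ^ (1 / (8 * d) : ℝ) * (1 + 4 * (1 - ratio)⁻¹)).toNNReal, fun n x hx φ hφ => ?_⟩
  obtain ⟨hN, s, -, t, -, h⟩ := hD n x hx
  obtain ⟨π, hπ, hdist⟩ := h φ hφ
  have hn := D.length_pos n x hx
  -- The only place where the value `2 ^ (n ^ 2)` of `N` enters as an exact equality between `X` and
  -- the target bound.
  have hX : (2 ^ n * ((φ : ℝ≥0) : ℝ≥0∞) ^ (1 / (n : ℝ))) ^ n = D.N n x * ((φ : ℝ≥0) : ℝ≥0∞) := by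
    have hn' : (n : ℝ) ≠ 0 := by exact_mod_cast hn.ne'
    rw [mul_pow, ← ENNReal.rpow_natCast (((φ : ℝ≥0) : ℝ≥0∞) ^ _), ← ENNReal.rpow_mul,
      one_div_mul_cancel hn',
      ENNReal.rpow_one, hN, ← pow_mul, sq]
    push_cast
    rfl
  set X := 2 ^ n * ((φ : ℝ≥0) : ℝ≥0∞) ^ (1 / (n : ℝ))
  -- Otherwise `N * φ = X ^ n < 1`, against `φ ≥ 1 / N`.
  have hX1 : 1 ≤ X := by
    by_contra! hlt
    refine (pow_lt_one₀ zero_le hlt hn.ne').not_ge ?_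
    rw [hX]
    have h1 := (D.param_mem n x hx φ hφ).1
    change 1 / (D.N n x : ℚ≥0) ≤ φ at h1
    have hpos : 0 < D.N n x := by rw [hN]; positivity
    rw [div_le_iff₀ (by exact_mod_cast hpos), mul_comm] at h1
    have h2 : (1 : ℝ≥0) ≤ D.N n x * (φ : ℝ≥0) := by exact_mod_cast h1
    exact_mod_cast h2
  rw [ENNReal.coe_mul, ENNReal.coe_toNNReal hfin, hdist, tsum_map_mul]
  refine (sum_rpow_le (C := C) (independentLaw π) (independentLaw_sum π)
    (fun i w => P.known s w t i = none) (fun w => runTime P M (encodeInstance n s w t) n φ) hd hn hX1 (fun w hw => ?_)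
    fun i hi => known_eq_none_sum_mul_le P hn s t π hπ hX1 hi).trans ?_
  · refine hT n s w t φ hn (hq n x hx φ hφ _ ?_) (hq' n x hx φ hφ)
    rw [hdist, ← PMF.mem_support_iff, PMF.mem_support_map_iff]
    exact ⟨w, hw, rfl⟩
  · rw [ENNReal.coe_mul, ENNReal.coe_mul, ENNReal.coe_natCast, ENNReal.coe_natCast,
      mul_assoc (n : ℝ≥0∞), ← hX]
    gcongr
    -- `X ≤ X ^ n`, that is, `X ≤ N * φ`.
    exact le_self_pow₀ hX1 hn.ne'

end SmoothedComplexity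

end

theorem mainTheorem3 (P : SmoothedComplexity.BinaryDecisionProblem)
    (hP : P.SolvableInPseudoPolyTime)
    (D : SmoothedComplexity.ParamFamily)
    (hD : SmoothedComplexity.IsPerturbationModel D) :
    (P.language, D) ∈ SmoothedComplexity.SmoothedP := by
  obtain ⟨M, p, hM⟩ := hP
  exact ⟨SmoothedComplexity.smoothedMachine M, SmoothedComplexity.runTime P M,
    SmoothedComplexity.smoothedMachine_answers hM,
    SmoothedComplexity.hasSmoothedPolyTime_runTime hM hD⟩
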